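/- Let $A\in SL(2,\mathbb Z)$ with $\operatorname{tr}A>2$, let $a>1$ be its larger eigenvalue and $v_\pm$ eigenvectors, $Av_\pm=a^{\pm1}v_\pm$, $dvol_{T^2}(v_+,v_-)>0$. Let $T_A=T^2\times[0,1]/((x,1)\sim(Ax,0))\ni(x,z)$ be the mapping torus, $\beta_\pm=\pm a^{\mp z}dvol_{T^2}(v_\pm,\cdot)$, and $\lambda=\beta_++s\beta_-$ the Liouville form on Mitsumatsu's cylinder $W_A=[-1,1]\times T_A\ni(s,(x,z))$. **Lutz tube.** The Liouville flow of $\lambda$ gives a collar of each of the two ends $s=\pm1$, with collar parameter $\tau=\frac12\log|s|\le0$ and $\lambda=e^\tau\mu$, where $\mu$ is a contact form on the end. The contactization $(W_A\times\mathbb R\ni t,\ \lambda+dt)$ is modified near $-\epsilon'<\tau\le0$ to a contact form $F(s)\lambda+G(s)dt$ ($F,G$ smooth and positive for $|s|<1$, and $F=G=1$ away from the collars) which equals $e^{-\tau^2/\epsilon'}\mu-\frac{\tau}{\epsilon'}dt$ for $-\epsilon'<\tau\le 0$; then $t$ is taken modulo $2\pi c$ ($c>0$), and the end $s=-1$ is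 capped off by collapsing the circles $\mathbb R/2\pi c\mathbb Z$ there, i.e. by gluing in $T_A\times D^2$ with contact structure $\ker(\mu+r^2d\theta)$, $\theta=t/c$. The result is $T_A\times D^2$ with a contact structure $\ker\alpha$, with core $s=-1$ and boundary $s=1$, called a $5$-dimensional Lutz tube associated to $A$. The complement of the core in its interior is identified with the contactization $(\mathbb R\times T_A\times\mathbb R/2\pi c\mathbb Z,\ \beta_++s\beta_-+dt)$ of the completion of $W_A$, by $(s,(x,z),t)\mapsto(k^2s,(x,z-\log k/\log a),t)$ with $k=F(s)/G(s)$. **Plastikstufe.** A plastikstufe in a contact $5$-manifold $(M,\ker\alpha)$ is the image of an embedding $j:D^2\times S^1\to M$ such that $j(\partial D^2\times S^1)$ is Legendrian and, for some function $f(r)$, $0<r<1$, $$(r^2d\theta+f(r)dr)\wedge j^*\alpha\equiv0,\qquad \lim_{r\to0}\frac{f(r)}{r^2}=0,\qquad \lim_{r\to1}|f(r)|=\infty .$$ It is said to be of class $C^k$ if $j$ is a $C^k$ embedding of the closed solid torus and is $C^\infty$ on its interior; here $f$ is required to be smooth on $(0,1)$. **Theorem.** Every $5$-dimensional Lutz tube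 $T_A\times D^2$ ($\operatorname{tr}A>2$) contains a plastikstufe of class $C^\infty$. Moreover, for every smooth function $g:\mathbb R\to\mathbb R$ with $g(s)=0$ for $s\le1$ and $g(s)=\frac1{s\log s}$ for $s\ge2$, and for all sufficiently small $\varepsilon>0$, the compactification (the closure in the Lutz tube) of the submanifold $$\mathcal P=\{x=p\,v_++q\,v_-,\quad p=\varepsilon a^{-z}g(s),\quad q=\varepsilon a^{z}s\,g(s)\}$$ of the contactization $\mathbb R\times T_A\times\mathbb R/2\pi c\mathbb Z\ni(s,(x,z),t)$ is a plastikstufe of class $C^1$ in the Lutz tube. -/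

import Mathlib

open Set Filter Topology Matrix
open scoped Manifold ContDiff

noncomputable section

/-! # Contact forms, plastikstufes, and five-dimensional Lutz tubes -/

/-- A `1`-form `η` on a `5`-dimensional vector space `V` is a contact form along `U`: it does not
vanish, and `dη` is nondegenerate on `ker η` (that is, `η ∧ (dη)^2 ≠ 0`). -/
def IsContactFormOn {V : Type*} [NormedAddCommGroup V] [NormedSpace ℝ V]
    (η : V → V →L[ℝ] ℝ) (U : Set V) : Prop :=
  ∀ x ∈ U, η x ≠ 0 ∧ ∀ v, η x v = 0 → v ≠ 0 →
    ∃ w, η x w = 0 ∧ fderiv ℝ η x v w - fderiv ℝ η x w v ≠ 0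

/-- The `1`-form `r² dθ + f(r) dr` on the punctured plane, `(r, θ)` being polar coordinates:
`r² dθ (h) = Im (w̄ h)` and `dr (h) = Re (w̄ h) / r`. -/
def spiralForm (f : ℝ → ℝ) (w h : ℂ) : ℝ :=
  ((starRingEnd ℂ) w * h).im + f ‖w‖ * (((starRingEnd ℂ) w * h).re / ‖w‖)

/-- The closed solid torus `D² × S¹` with `S¹ = ℝ / ℤ` unrolled: `D² × ℝ`. -/
def solidTorus : Set (ℂ × ℝ) := Metric.closedBall 0 1 ×ˢ univ

/-- `S` is a plastikstufe of class `C^k` in the manifold `N` with contact structure `ker α`: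
`S` is the image of an embedding `j` of `D² × S¹`, written as a map on `D² × ℝ` which is
`1`-periodic in the second variable, such that the boundary torus is Legendrian and
`(r² dθ + f(r) dr) ∧ j^* α = 0` for a function `f` with `f(r) / r² → 0` as `r → 0` and
`|f(r)| → ∞` as `r → 1`. The map `j` is `C^k` up to the boundary, and always `C^∞` on the
interior of the solid torus. -/
def IsPlastikstufe {E H N : Type*} [NormedAddCommGroup E] [NormedSpace ℝ E] [TopologicalSpace H]
    (I : ModelWithCorners ℝ E H) [TopologicalSpace N] [ChartedSpace H N] (k : ℕ∞ω)
    (α : ∀ m : N, TangentSpace I m →L[ℝ] ℝ) (S : Set N) : Prop :=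
  ∃ (j : ℂ × ℝ → N) (f : ℝ → ℝ),
    -- `j` is a map on `D² × S¹` with image `S`, of the stated regularity
    (∀ w u, j (w, u + 1) = j (w, u)) ∧
    j '' solidTorus = S ∧
    ContMDiffOn 𝓘(ℝ, ℂ × ℝ) I k j solidTorus ∧
    ContMDiffOn 𝓘(ℝ, ℂ × ℝ) I ∞ j (Metric.ball 0 1 ×ˢ univ) ∧
    -- `j` is an injective immersion of the compact manifold `D² × S¹`, hence an embedding
    (∀ x ∈ solidTorus, ∀ y ∈ solidTorus, j x = j y → x.1 = y.1 ∧ ∃ n : ℤ, y.2 = x.2 + n) ∧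
    (∀ x ∈ solidTorus,
      Function.Injective (mfderivWithin 𝓘(ℝ, ℂ × ℝ) I j solidTorus x)) ∧
    -- the boundary torus is Legendrian
    (∀ x ∈ solidTorus, ‖x.1‖ = 1 → ∀ h : ℂ × ℝ, ((starRingEnd ℂ) x.1 * h.1).re = 0 →
      α (j x) (mfderivWithin 𝓘(ℝ, ℂ × ℝ) I j solidTorus x h) = 0) ∧
    -- the characteristic foliation on the interior
    (∀ x : ℂ × ℝ, 0 < ‖x.1‖ → ‖x.1‖ < 1 → ∀ h h' : ℂ × ℝ,
      spiralForm f x.1 h.1 * α (j x) (mfderivWithin 𝓘(ℝ, ℂ × ℝ) I j solidTorus x h') -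
      spiralForm f x.1 h'.1 * α (j x) (mfderivWithin 𝓘(ℝ, ℂ × ℝ) I j solidTorus x h) = 0) ∧
    ContDiffOn ℝ ∞ f (Ioo 0 1) ∧
    Tendsto (fun r => f r / r ^ 2) (𝓝[>] 0) (𝓝 0) ∧
    Tendsto (fun r => |f r|) (𝓝[<] 1) atTop

/-! ## The mapping torus `T_A` -/

/-- The universal cover `ℝ² × ℝ` of `T_A`, with coordinates `(x, z)`. -/
abbrev SolCover : Type := (Fin 2 → ℝ) × ℝ

/-- The linear action of a matrix in `SL(2, ℤ)` on `ℝ²`. -/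
def slLin (A : SpecialLinearGroup (Fin 2) ℤ) : (Fin 2 → ℝ) →L[ℝ] (Fin 2 → ℝ) :=
  LinearMap.toContinuousLinearMap ((A.1.map (Int.cast : ℤ → ℝ)).mulVecLin)

/-- The deck transformation `(x, z) ↦ (Aⁿ x + m, z - n)`. -/
def deck (A : SpecialLinearGroup (Fin 2) ℤ) (n : ℤ) (m : Fin 2 → ℤ) (y : SolCover) : SolCover :=
  (slLin (A ^ n) y.1 + fun i => (m i : ℝ), y.2 - n)

theorem slLin_mul (A B : SpecialLinearGroup (Fin 2) ℤ) (x : Fin 2 → ℝ) :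
    slLin (A * B) x = slLin A (slLin B x) := by
  simp [slLin, Matrix.map_mul_intCast]

theorem slLin_one (x : Fin 2 → ℝ) : slLin 1 x = x := by
  simp [slLin, Matrix.map_one]

theorem slLin_int (A : SpecialLinearGroup (Fin 2) ℤ) (m : Fin 2 → ℤ) :
    slLin A (fun i => (m i : ℝ)) = fun i => ((A.1 *ᵥ m) i : ℝ) := by
  ext i; simp [slLin, Matrix.mulVec, dotProduct]

theorem deck_zero (A : SpecialLinearGroup (Fin 2) ℤ) (y : SolCover) : deck A 0 0 y = y := by
  ext <;> simp [deck, slLin_one]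

theorem deck_deck (A : SpecialLinearGroup (Fin 2) ℤ) (n n' : ℤ) (m m' : Fin 2 → ℤ) (y : SolCover) :
    deck A n m (deck A n' m' y) = deck A (n + n') ((A ^ n).1 *ᵥ m' + m) y := by
  ext i
  · simp only [deck, _root_.zpow_add, slLin_mul, map_add, slLin_int]
    simp only [Pi.add_apply, Int.cast_add]; ring
  · simp [deck]; ring

theorem deck_inv (A : SpecialLinearGroup (Fin 2) ℤ) (n : ℤ) (m : Fin 2 → ℤ) (y : SolCover) :
    deck A (-n) (-((A ^ (-n)).1 *ᵥ m)) (deck A n m y) = y := by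
  rw [deck_deck, neg_add_cancel, add_neg_cancel, deck_zero]

/-- Two points of the cover are identified iff they differ by a deck transformation. This is the
equivalence relation generated by `(x, z) ∼ (x + m, z)`, `m ∈ ℤ²`, and `(x, z + 1) ∼ (A x, z)`. -/
def solSetoid (A : SpecialLinearGroup (Fin 2) ℤ) : Setoid SolCover where
  r y y' := ∃ n m, y' = deck A n m y
  iseqv :=
    { refl := fun y => ⟨0, 0, (deck_zero A y).symm⟩
      symm := by
        rintro y _ ⟨n, m, rfl⟩
        exact ⟨_, _, (deck_inv A n m y).symm⟩
      trans := by
        rintro y _ _ ⟨n, m, rfl⟩ ⟨n', m', rfl⟩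
        exact ⟨_, _, deck_deck A n' n m' m y⟩ }

/-- The mapping torus `T_A = T² × [0, 1] / (x, 1) ∼ (A x, 0)`. -/
def MapTorus (A : SpecialLinearGroup (Fin 2) ℤ) : Type := Quotient (solSetoid A)

namespace MapTorus

variable {A : SpecialLinearGroup (Fin 2) ℤ}

instance : TopologicalSpace (MapTorus A) :=
  inferInstanceAs (TopologicalSpace (Quotient (solSetoid A)))

/-- The universal covering `ℝ² × ℝ → T_A`. -/
def proj (A : SpecialLinearGroup (Fin 2) ℤ) (y : SolCover) : MapTorus A :=
  Quotient.mk (solSetoid A) y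

/-- A chosen preimage. -/
def out (m : MapTorus A) : SolCover := Quotient.out m

theorem proj_out (m : MapTorus A) : proj A m.out = m := Quotient.out_eq m

theorem proj_eq_iff {y y' : SolCover} : proj A y = proj A y' ↔ ∃ n m, y' = deck A n m y :=
  Quotient.eq

theorem continuous_proj : Continuous (proj A) := continuous_quotient_mk'

theorem contDiff_deck (n : ℤ) (m : Fin 2 → ℤ) : ContDiff ℝ ∞ (deck A n m) := by
  unfold deck; fun_prop

theorem isOpenMap_proj : IsOpenMap (proj A) := by
  intro U hU
  have h : proj A ⁻¹' (proj A '' U) = ⋃ (n : ℤ) (m : Fin 2 → ℤ), deck A n m ⁻¹' U := by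
    ext y
    simp only [mem_preimage, mem_image, mem_iUnion]
    constructor
    · rintro ⟨u, hu, huy⟩
      obtain ⟨n, m, rfl⟩ := proj_eq_iff.1 huy.symm
      exact ⟨n, m, hu⟩
    · rintro ⟨n, m, hu⟩
      exact ⟨_, hu, (proj_eq_iff.2 ⟨n, m, rfl⟩).symm⟩
  have : IsOpen (proj A ⁻¹' (proj A '' U)) := by
    rw [h]
    exact isOpen_iUnion fun n => isOpen_iUnion fun m =>
      hU.preimage (contDiff_deck n m).continuous
  exact this

theorem injOn_proj (y : SolCover) : InjOn (proj A) (Metric.ball y (1 / 4)) := by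
  intro u hu v hv huv
  obtain ⟨n, m, rfl⟩ := proj_eq_iff.1 huv
  have hd : dist u (deck A n m u) < 1 / 2 := by
    have := dist_triangle_right u (deck A n m u) y
    rw [Metric.mem_ball] at hu hv
    linarith
  rw [Prod.dist_eq, max_lt_iff] at hd
  obtain ⟨h1, h2⟩ := hd
  have hn : n = 0 := by
    have : |(n : ℝ)| < 1 := by
      rw [Real.dist_eq] at h2
      have e : u.2 - (deck A n m u).2 = n := by simp [deck]
      rw [e] at h2; linarith
    exact Int.abs_lt_one_iff.1 (by exact_mod_cast this)
  subst hn
  have hm : m = 0 := by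
    funext i
    have hi := (dist_le_pi_dist u.1 (deck A 0 m u).1 i).trans_lt h1
    have : |(m i : ℝ)| < 1 := by
      rw [Real.dist_eq] at hi
      have e : u.1 i - (deck A 0 m u).1 i = -(m i : ℝ) := by simp [deck, slLin_one]
      rw [e, abs_neg] at hi; linarith
    exact Int.abs_lt_one_iff.1 (by exact_mod_cast this)
  subst hm
  exact (deck_zero A u).symm

/-- The covering restricted to a small ball, as an open partial homeomorphism. -/
def ballHomeo (A : SpecialLinearGroup (Fin 2) ℤ) (y : SolCover) :
    OpenPartialHomeomorph SolCover (MapTorus A) :=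
  OpenPartialHomeomorph.ofContinuousOpen (InjOn.toPartialEquiv (proj A) _ (injOn_proj y))
    continuous_proj.continuousOn isOpenMap_proj Metric.isOpen_ball

theorem ballHomeo_source (y : SolCover) : (ballHomeo A y).source = Metric.ball y (1 / 4) := rfl

theorem ballHomeo_apply (y u : SolCover) : ballHomeo A y u = proj A u := rfl

/-- `T_A` as a manifold: the charts are the local inverses of the covering. -/
instance : ChartedSpace SolCover (MapTorus A) where
  atlas := range fun y => (ballHomeo A y).symm
  chartAt m := (ballHomeo A m.out).symm
  mem_chart_source m := by
    have := (ballHomeo A m.out).map_source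
      (show m.out ∈ (ballHomeo A m.out).source from Metric.mem_ball_self (by norm_num))
    rwa [ballHomeo_apply, proj_out] at this
  chart_mem_atlas m := ⟨_, rfl⟩

theorem ballHomeo_symm_proj_eventuallyEq {y u : SolCover} (hu : proj A u ∈ (ballHomeo A y).target) :
    ∃ n m, (fun v => (ballHomeo A y).symm (proj A v)) =ᶠ[𝓝 u] deck A n m := by
  have hr := (ballHomeo A y).right_inv hu
  rw [ballHomeo_apply] at hr
  obtain ⟨n, m, hnm⟩ := proj_eq_iff.1 hr.symm
  refine ⟨n, m, ?_⟩
  have hmem : deck A n m u ∈ (ballHomeo A y).source := hnm ▸ (ballHomeo A y).map_target hu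
  have hev := (contDiff_deck (A := A) n m).continuous.continuousAt.eventually
    ((ballHomeo A y).open_source.mem_nhds hmem)
  filter_upwards [hev] with v hv
  have := (ballHomeo A y).left_inv hv
  rwa [ballHomeo_apply, ← proj_eq_iff.2 ⟨n, m, rfl⟩] at this

instance : IsManifold 𝓘(ℝ, SolCover) ∞ (MapTorus A) := by
  apply isManifold_of_contDiffOn
  rintro _ _ ⟨y, rfl⟩ ⟨y', rfl⟩ u hu
  have hu' : proj A u ∈ (ballHomeo A y').target := by
    have := hu.1
    simpa [ballHomeo_apply] using this.2
  obtain ⟨n, m, h⟩ := ballHomeo_symm_proj_eventuallyEq hu'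
  exact ((contDiff_deck n m).contDiffAt.congr_of_eventuallyEq h).contDiffWithinAt

theorem isLocalDiffeomorph_proj :
    IsLocalDiffeomorph 𝓘(ℝ, SolCover) 𝓘(ℝ, SolCover) ∞ (proj A) := by
  intro y
  have hmem : (ballHomeo A y).symm ∈ IsManifold.maximalAtlas 𝓘(ℝ, SolCover) ∞ (MapTorus A) :=
    IsManifold.subset_maximalAtlas ⟨y, rfl⟩
  exact ⟨{ toPartialEquiv := (ballHomeo A y).toPartialEquiv
           open_source := (ballHomeo A y).open_source
           open_target := (ballHomeo A y).open_target
           contMDiffOn_toFun := contMDiffOn_symm_of_mem_maximalAtlas hmem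
           contMDiffOn_invFun := contMDiffOn_of_mem_maximalAtlas hmem },
    Metric.mem_ball_self (by norm_num), fun _ _ => rfl⟩

end MapTorus

/-! ## The forms `β₊`, `β₋` and the contactization -/

/-- The eigenvalue `a > 1` of `A` and eigenvectors `v₊`, `v₋` with `A v₊ = a v₊`,
`A v₋ = a⁻¹ v₋` and `dvol (v₊, v₋) > 0`. -/
structure EigenFrame (A : SpecialLinearGroup (Fin 2) ℤ) where
  a : ℝ
  vp : Fin 2 → ℝ
  vm : Fin 2 → ℝ
  one_lt_a : 1 < a
  map_vp : slLin A vp = a • vp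
  map_vm : slLin A vm = a⁻¹ • vm
  area_pos : 0 < vp 0 * vm 1 - vp 1 * vm 0

/-- The `1`-form `dvol (v, ·)` on `ℝ²`. -/
def areaForm (v : Fin 2 → ℝ) : (Fin 2 → ℝ) →L[ℝ] ℝ :=
  v 0 • ContinuousLinearMap.proj 1 - v 1 • ContinuousLinearMap.proj 0

namespace EigenFrame

variable {A : SpecialLinearGroup (Fin 2) ℤ} (e : EigenFrame A)

/-- `β₊ = a^{-z} dvol (v₊, ·)`, on the universal cover of `T_A`. -/
def betaP (y : SolCover) : SolCover →L[ℝ] ℝ :=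
  (e.a ^ (-y.2)) • (areaForm e.vp).comp (ContinuousLinearMap.fst ℝ _ _)

/-- `β₋ = - a^{z} dvol (v₋, ·)`, on the universal cover of `T_A`. -/
def betaM (y : SolCover) : SolCover →L[ℝ] ℝ :=
  -(e.a ^ y.2) • (areaForm e.vm).comp (ContinuousLinearMap.fst ℝ _ _)

/-- The form `F(s) (β₊ + s β₋) + G(s) dt` on (the cover of) `ℝ × T_A × ℝ ∋ (s, (x, z), t)`.
For `F = G = 1` this is the contactization of `(ℝ × T_A, d(β₊ + s β₋))`. -/
def cylForm (F G : ℝ → ℝ) (y : ℝ × SolCover × ℝ) : ℝ × SolCover × ℝ →L[ℝ] ℝ :=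
  F y.1 • (e.betaP y.2.1 + y.1 • e.betaM y.2.1).comp
      ((ContinuousLinearMap.fst ℝ _ _).comp (ContinuousLinearMap.snd ℝ _ _)) +
    G y.1 • (ContinuousLinearMap.snd ℝ _ _).comp (ContinuousLinearMap.snd ℝ _ _)

theorem areaForm_zpow (n : ℤ) (u v : Fin 2 → ℝ) :
    areaForm (slLin (A ^ n) u) (slLin (A ^ n) v) = areaForm u v := by
  have h : ((A ^ n).1.map (Int.cast : ℤ → ℝ)).det = 1 := by
    have := (A ^ n).2
    rw [show ((A ^ n).1.map (Int.cast : ℤ → ℝ)) = (Int.castRingHom ℝ).mapMatrix (A ^ n).1 from rfl,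
      ← RingHom.map_det, this, map_one]
  rw [Matrix.det_fin_two] at h
  simp only [Matrix.map_apply] at h
  simp [areaForm, slLin, Matrix.mulVec, dotProduct, Fin.sum_univ_two]
  linear_combination (u 0 * v 1 - u 1 * v 0) * h

theorem slLin_zpow {b : ℝ} (hb : b ≠ 0) {v : Fin 2 → ℝ} (hv : slLin A v = b • v) (n : ℤ) :
    slLin (A ^ n) v = b ^ n • v := by
  have hinv : slLin A⁻¹ v = b⁻¹ • v := by
    have : slLin A⁻¹ (slLin A v) = v := by rw [← slLin_mul, inv_mul_cancel, slLin_one]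
    rw [hv, map_smul] at this
    rw [← this, smul_smul, inv_mul_cancel₀ hb, one_smul, this]
  induction n with
  | zero => simp [slLin_one]
  | succ n ih =>
    rw [_root_.zpow_add_one, slLin_mul, hv, map_smul, ih, smul_smul, zpow_add_one₀ hb, mul_comm]
  | pred n ih =>
    rw [_root_.zpow_sub_one, slLin_mul, hinv, map_smul, ih, smul_smul, zpow_sub_one₀ hb, mul_comm]

theorem areaForm_smul (b : ℝ) (u v : Fin 2 → ℝ) : areaForm (b • u) v = b * areaForm u v := by
  simp [areaForm]; ring

theorem betaP_deck (n : ℤ) (m : Fin 2 → ℤ) (y v : SolCover) :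
    e.betaP (deck A n m y) (slLin (A ^ n) v.1, v.2) = e.betaP y v := by
  have ha : 0 < e.a := zero_lt_one.trans e.one_lt_a
  have h := areaForm_zpow (A := A) n e.vp v.1
  rw [slLin_zpow ha.ne' e.map_vp, areaForm_smul] at h
  simp only [betaP, deck, _root_.smul_apply, ContinuousLinearMap.comp_apply,
    ContinuousLinearMap.coe_fst', smul_eq_mul]
  rw [← h, neg_sub, sub_eq_neg_add, Real.rpow_add ha, Real.rpow_intCast, mul_assoc]

theorem betaM_deck (n : ℤ) (m : Fin 2 → ℤ) (y v : SolCover) :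
    e.betaM (deck A n m y) (slLin (A ^ n) v.1, v.2) = e.betaM y v := by
  have ha : 0 < e.a := zero_lt_one.trans e.one_lt_a
  have h := areaForm_zpow (A := A) n e.vm v.1
  rw [slLin_zpow (inv_ne_zero ha.ne') e.map_vm, areaForm_smul] at h
  simp only [betaM, deck, _root_.smul_apply, ContinuousLinearMap.comp_apply,
    ContinuousLinearMap.coe_fst', smul_eq_mul, neg_mul]
  rw [← h, sub_eq_add_neg, Real.rpow_add ha, Real.rpow_neg ha.le, Real.rpow_intCast, _root_.inv_zpow,
    mul_assoc]

end EigenFrame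

/-- The choices in the modified contactization of `W_A = [-1, 1] × T_A` (with `λ = β₊ + s β₋`), and
in its quotient by a translation in `t`.

The flow of the Liouville field `2 s ∂_s - (log a)⁻¹ ∂_z` gives collars of both ends `s = ±1` with
collar parameter `τ = log |s| / 2 ≤ 0`, on which `λ = e^τ μ` with `μ` a contact form on `T_A`.
The form `λ + dt` is modified near `-ε < τ ≤ 0` into a contact form
`F(s) λ + G(s) dt` that is equal there to `e^{-τ²/ε} μ - (τ/ε) dt`, i.e.
`F = e^{-τ²/ε - τ}` and `G = -τ/ε`. (The values of `F`, `G` outside `[-1, 1]` are irrelevant.)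
Finally `t` is taken modulo `2 π c`. -/
structure LutzProfile {A : SpecialLinearGroup (Fin 2) ℤ} (e : EigenFrame A) where
  ε : ℝ
  δ : ℝ
  c : ℝ
  F : ℝ → ℝ
  G : ℝ → ℝ
  ε_pos : 0 < ε
  δ_pos : 0 < δ
  c_pos : 0 < c
  smooth_F : ContDiff ℝ ∞ F
  smooth_G : ContDiff ℝ ∞ G
  unmodified : ∀ s, Real.log |s| / 2 ≤ -(ε + δ) ∨ s = 0 → |s| ≤ 1 → F s = 1 ∧ G s = 1
  collar : ∀ s, s ≠ 0 → |s| ≤ 1 → -ε < Real.log |s| / 2 →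
    F s = Real.exp (-(Real.log |s| / 2) ^ 2 / ε - Real.log |s| / 2) ∧
    G s = -(Real.log |s| / 2) / ε
  pos : ∀ s ∈ Ioo (-1 : ℝ) 1, 0 < F s ∧ 0 < G s
  contact : IsContactFormOn (e.cylForm F G) {y | y.1 ∈ Icc (-1 : ℝ) 1}

/-! ## The Lutz tube -/

/-- The radial coordinate `s = 2 |w|² - 1 ∈ [-1, 1]` on the unit disk: the core `w = 0` is `s = -1`
and the boundary `|w| = 1` is `s = 1`. -/
def sOf (w : ℂ) : ℝ := 2 * ‖w‖ ^ 2 - 1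

/-- The `1`-form `dθ` at the point `w` of the punctured plane: `dθ (h) = Im (w̄ h) / |w|²`. -/
def dTheta (w : ℂ) : ℂ →L[ℝ] ℝ :=
  (‖w‖ ^ 2)⁻¹ • Complex.imCLM.comp
    ((ContinuousLinearMap.mul ℝ ℂ) ((starRingEnd ℂ) w))

/-- The Lutz tube is `T_A × D²`, inside the open manifold `T_A × ℂ`. -/
def lutzTube (A : SpecialLinearGroup (Fin 2) ℤ) : Set (MapTorus A × ℂ) :=
  univ ×ˢ Metric.closedBall 0 1

namespace LutzProfile

variable {A : SpecialLinearGroup (Fin 2) ℤ} {e : EigenFrame A} (P : LutzProfile e)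

/-- The contact form of the Lutz tube on the universal cover `ℝ² × ℝ × D²` of `T_A × D²`. For
`w ≠ 0` it is the modified contactization form `F(s) (β₊ + s β₋) + G(s) dt` with `s = 2|w|² - 1` and
`t = c θ`; this glues in the core `w = 0`, where the circle of `t` is collapsed. Near the core,
up to a positive factor and in the collar coordinate `z + τ / log a` in place of `z`, it is
`μ + ρ dθ`, where `ρ = c G / e^{-τ²/ε}` is a smooth function of
`|w|²` with a simple zero at `0`: this is the capping off by `(T_A × D², μ + r² dθ)`, `r² = ρ`. -/
def coverForm (y : SolCover × ℂ) : SolCover × ℂ →L[ℝ] ℝ :=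
  P.F (sOf y.2) • (e.betaP y.1 + sOf y.2 • e.betaM y.1).comp (ContinuousLinearMap.fst ℝ _ _) +
    (P.c * P.G (sOf y.2)) • (dTheta y.2).comp (ContinuousLinearMap.snd ℝ _ _)

/-- The contact form on `T_A × D²`: the form whose pull-back to the universal cover is `coverForm`
(see `lutzForm_proj`). -/
def lutzForm (m : MapTorus A × ℂ) :
    TangentSpace (𝓘(ℝ, SolCover).prod 𝓘(ℝ, ℂ)) m →L[ℝ] ℝ :=
  (P.coverForm (m.1.out, m.2)).comp
    ((ContinuousLinearMap.inverse
      (mfderiv 𝓘(ℝ, SolCover) 𝓘(ℝ, SolCover) (MapTorus.proj A) m.1.out)).prodMap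
        (ContinuousLinearMap.id ℝ ℂ))

theorem coverForm_deck (n : ℤ) (m : Fin 2 → ℤ) (y : SolCover) (w : ℂ) (v : SolCover × ℂ) :
    P.coverForm (deck A n m y, w) ((slLin (A ^ n) v.1.1, v.1.2), v.2) = P.coverForm (y, w) v := by
  simp only [coverForm, _root_.add_apply, _root_.smul_apply,
    ContinuousLinearMap.comp_apply, ContinuousLinearMap.coe_fst', ContinuousLinearMap.coe_snd',
    e.betaP_deck, e.betaM_deck]

/-- The pull-back of `lutzForm` to the universal cover is `coverForm`. -/
theorem lutzForm_proj (y : SolCover) (w : ℂ) (v : SolCover × ℂ) :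
    P.lutzForm (MapTorus.proj A y, w)
      (mfderiv 𝓘(ℝ, SolCover) 𝓘(ℝ, SolCover) (MapTorus.proj A) y v.1, v.2) =
      P.coverForm (y, w) v := by
  set x := (MapTorus.proj A y).out with hx
  obtain ⟨n, m, hnm⟩ := MapTorus.proj_eq_iff.1 (MapTorus.proj_out (MapTorus.proj A y))
  rw [← hx] at hnm
  -- the derivative of the covering at `x` and at `y`
  have hd : HasFDerivAt (deck A n m)
      (((slLin (A ^ n)).prodMap (ContinuousLinearMap.id ℝ ℝ))) x := by
    have h := ((slLin (A ^ n)).prodMap (ContinuousLinearMap.id ℝ ℝ)).hasFDerivAt (x := x)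
    have h2 := h.add_const ((fun i => (m i : ℝ), -(n : ℝ)) : SolCover)
    refine h2.congr_of_eventuallyEq (Eventually.of_forall fun u => ?_)
    ext <;> simp [deck, sub_eq_add_neg]
  have hdiff := (MapTorus.isLocalDiffeomorph_proj (A := A)).mdifferentiable (by simp)
  have hcomp : MapTorus.proj A ∘ deck A n m = MapTorus.proj A :=
    funext fun u => (MapTorus.proj_eq_iff.2 ⟨n, m, rfl⟩).symm
  have hD : ∀ u : SolCover, mfderiv 𝓘(ℝ, SolCover) 𝓘(ℝ, SolCover) (MapTorus.proj A) x u =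
      mfderiv 𝓘(ℝ, SolCover) 𝓘(ℝ, SolCover) (MapTorus.proj A) y (slLin (A ^ n) u.1, u.2) := by
    intro u
    have h1 := mfderiv_comp (I := 𝓘(ℝ, SolCover)) (I' := 𝓘(ℝ, SolCover)) (I'' := 𝓘(ℝ, SolCover)) x
      (hdiff (deck A n m x)) hd.hasMFDerivAt.mdifferentiableAt
    rw [hcomp, hd.hasMFDerivAt.mfderiv, ← hnm] at h1
    rw [h1]; rfl
  obtain ⟨v₁, hv₁⟩ : ∃ v₁ : SolCover, (slLin (A ^ n) v₁.1, v₁.2) = v.1 := by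
    refine ⟨(slLin (A ^ (-n)) v.1.1, v.1.2), ?_⟩
    rw [← slLin_mul, ← _root_.zpow_add, add_neg_cancel, zpow_zero, slLin_one]
  have hinv : ContinuousLinearMap.inverse
      (mfderiv 𝓘(ℝ, SolCover) 𝓘(ℝ, SolCover) (MapTorus.proj A) x)
      (mfderiv 𝓘(ℝ, SolCover) 𝓘(ℝ, SolCover) (MapTorus.proj A) y v.1) = v₁ := by
    rw [← hv₁, ← hD]
    rw [← (MapTorus.isLocalDiffeomorph_proj (A := A)).mfderivToContinuousLinearEquiv_coe
      (by simp) x]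
    rw [ContinuousLinearMap.inverse_equiv]
    exact ContinuousLinearEquiv.symm_apply_apply _ _
  have hfin : P.coverForm (x, w) (v₁, v.2) = P.coverForm (y, w) v := by
    rw [← P.coverForm_deck n m x w (v₁, v.2), hv₁, ← hnm]
  rw [← hfin]
  exact congrArg (fun u : SolCover => P.coverForm (x, w) (u, v.2)) hinv

/-- The contactomorphism from the interior `(-1, 1) × T_A × ℝ` of the modified contactization to
the contactization `(ℝ × T_A × ℝ, β₊ + s β₋ + dt)` of the full extension of `W_A`: with
`k = F(s) / G(s)`, it moves `(s, (x, z))` by the time `log k` of the Liouville flow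
`(s, (x, z)) ↦ (e^{2T} s, (x, z - T / log a))`, which multiplies `λ` by `k`, and fixes `t`.
(See `cylForm_extend`.) -/
def extend (y : ℝ × SolCover × ℝ) : ℝ × SolCover × ℝ :=
  ((P.F y.1 / P.G y.1) ^ 2 * y.1,
    (y.2.1.1, y.2.1.2 - Real.log (P.F y.1 / P.G y.1) / Real.log e.a), y.2.2)

theorem cylForm_extend (y : ℝ × SolCover × ℝ) (hy : y.1 ∈ Ioo (-1 : ℝ) 1)
    (v : ℝ × SolCover × ℝ) :
    P.G y.1 * e.cylForm 1 1 (P.extend y) (fderiv ℝ P.extend y v) = e.cylForm P.F P.G y v := by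
  have hF := (P.pos y.1 hy).1
  have hG := (P.pos y.1 hy).2
  have ha : 0 < e.a := zero_lt_one.trans e.one_lt_a
  have hla : Real.log e.a ≠ 0 := (Real.log_pos e.one_lt_a).ne'
  have hk : 0 < P.F y.1 / P.G y.1 := div_pos hF hG
  have hdk : DifferentiableAt ℝ (fun y : ℝ × SolCover × ℝ => P.F y.1 / P.G y.1) y :=
    DifferentiableAt.comp (g := fun s => P.F s / P.G s) y
      (((P.smooth_F.differentiable (by simp)) y.1).fun_div
        ((P.smooth_G.differentiable (by simp)) y.1) hG.ne') differentiableAt_fst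
  have hdE : DifferentiableAt ℝ P.extend y := by
    unfold extend
    have := hdk.log hk.ne'
    fun_prop
  have hx : (fderiv ℝ P.extend y v).2.1.1 = v.2.1.1 := by
    have h2 := (((ContinuousLinearMap.fst ℝ (Fin 2 → ℝ) ℝ).comp
      ((ContinuousLinearMap.fst ℝ SolCover ℝ).comp
        (ContinuousLinearMap.snd ℝ ℝ (SolCover × ℝ)))).hasFDerivAt.comp y hdE.hasFDerivAt)
    have h3 := ((ContinuousLinearMap.fst ℝ (Fin 2 → ℝ) ℝ).comp
      ((ContinuousLinearMap.fst ℝ SolCover ℝ).comp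
        (ContinuousLinearMap.snd ℝ ℝ (SolCover × ℝ)))).hasFDerivAt (x := y)
    exact congrArg (fun L => L v) (h2.unique h3)
  have ht : (fderiv ℝ P.extend y v).2.2 = v.2.2 := by
    have h2 := (((ContinuousLinearMap.snd ℝ SolCover ℝ).comp
        (ContinuousLinearMap.snd ℝ ℝ (SolCover × ℝ))).hasFDerivAt.comp y hdE.hasFDerivAt)
    have h3 := ((ContinuousLinearMap.snd ℝ SolCover ℝ).comp
        (ContinuousLinearMap.snd ℝ ℝ (SolCover × ℝ))).hasFDerivAt (x := y)
    exact congrArg (fun L => L v) (h2.unique h3)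
  have hpow : e.a ^ (Real.log (P.F y.1 / P.G y.1) / Real.log e.a) = P.F y.1 / P.G y.1 := by
    rw [Real.rpow_def_of_pos ha, mul_div_cancel₀ _ hla, Real.exp_log hk]
  simp only [EigenFrame.cylForm, EigenFrame.betaP, EigenFrame.betaM, _root_.add_apply,
    _root_.smul_apply, ContinuousLinearMap.comp_apply, ContinuousLinearMap.coe_fst',
    ContinuousLinearMap.coe_snd', smul_eq_mul, hx, ht, Pi.one_apply]
  simp only [extend, sub_eq_add_neg (G := ℝ) y.2.1.2, neg_add, neg_neg]
  rw [Real.rpow_add ha, Real.rpow_add ha, Real.rpow_neg ha.le (_ / _), hpow]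
  field_simp

/-- The point of `T_A × D²` with coordinates `(s, (x, z), t)`. -/
def tubePoint (y : ℝ × SolCover × ℝ) : MapTorus A × ℂ :=
  (MapTorus.proj A y.2.1,
    (Real.sqrt ((1 + y.1) / 2) : ℂ) * Complex.exp ((y.2.2 / P.c : ℝ) * Complex.I))

/-- The submanifold `{p = ε a^{-z} g(s), q = ε a^z s g(s)}` of the contactization
`ℝ × T_A × ℝ`, seen in the cover; `(p, q)` are the coordinates of `x` in the basis `v₊`, `v₋`. -/
def spiralCyl (e : EigenFrame A) (g : ℝ → ℝ) (ε : ℝ) : Set (ℝ × SolCover × ℝ) :=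
  {y | y.2.1.1 = (ε * e.a ^ (-y.2.1.2) * g y.1) • e.vp + (ε * e.a ^ y.2.1.2 * y.1 * g y.1) • e.vm}

/-- The compactification of the above submanifold in the Lutz tube `T_A × D²`: the closure of its
image under the identification of the contactization with the interior of the tube minus its core
(`t` being taken modulo `2 π c`). -/
def compactification (g : ℝ → ℝ) (ε : ℝ) : Set (MapTorus A × ℂ) :=
  closure (P.tubePoint '' {y | y.1 ∈ Ioo (-1 : ℝ) 1 ∧ P.extend y ∈ spiralCyl e g ε})

end LutzProfile

end

open Set Filter Topology Matrix
open scoped Manifold ContDiff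

noncomputable section

/-! ## Maps from the solid torus to the Lutz tube determined by a profile function -/

/-! Everything reduces to one function `p` of `s`. The solid torus is mapped by taking `(w, z)` as
coordinates and setting `x = p(s) a^{-z} v₊ + s p(s) a^z v₋`. The powers of `a` make this invariant
under the deck group, and since `w` and `z` can be read off the image, it is an embedding for any
`p`. The coefficients of `v₊` and `v₋` are chosen so that the `dz` parts of `β₊` and `s β₋` cancel:
the contact form pulls back to `F area (p + 2 s p') ds + c G dθ`. This is a multiple of `r² dθ + f
dr`, where `f` is `r³ (p + 2 s p') / G` times a regular factor. If `p = 0` for `s ≤ 0`, then `f`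
vanishes near the core; as `G(1) = 0`, the boundary is Legendrian. What remains is that `|p + 2 s
p'| / G` tends to infinity at `s = 1` (`isPlastikstufe_spiralEmb`). A smooth example is any smooth
`p` with `p(1) = 1` and `p'(1) = 0`. The submanifold in the theorem is the case `p = ε k g(k² s)`,
`k = F / G`. In the collar, with `σ = -τ`, this is a smooth factor times `σ / L(σ)`, where `L(σ) = b
- c σ² - 2 log σ`. It is `C¹` up to `σ = 0` because `1 / L → 0`, and its derivative divided by `G =
σ / P.ε` is at least of order `1 / (σ L)`, which tends to infinity. -/

theorem contDiff_sOf {n : ℕ∞ω} : ContDiff ℝ n sOf :=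
  (contDiff_const.mul (contDiff_norm_sq ℝ)).sub contDiff_const

/-- The differential of `s = 2 |w|² - 1`. -/
def dsOf (w : ℂ) : ℂ →L[ℝ] ℝ :=
  (4 : ℝ) • Complex.reCLM.comp ((ContinuousLinearMap.mul ℝ ℂ) ((starRingEnd ℂ) w))

theorem dsOf_apply (w h : ℂ) : dsOf w h = 4 * ((starRingEnd ℂ) w * h).re := rfl

theorem dTheta_apply (w h : ℂ) :
    dTheta w h = (‖w‖ ^ 2)⁻¹ * ((starRingEnd ℂ) w * h).im := rfl

theorem hasFDerivAt_sOf (w : ℂ) : HasFDerivAt sOf (dsOf w) w := by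
  have h := (((hasFDerivAt_id (𝕜 := ℝ) w).norm_sq).const_mul 2).sub_const 1
  refine h.congr_fderiv ?_
  ext; simp [dsOf, Complex.inner]; ring

theorem sOf_mem_Iic {w : ℂ} (hw : ‖w‖ ≤ 1) : sOf w ∈ Iic (1 : ℝ) := by
  have := norm_nonneg w
  simp only [sOf, mem_Iic]; nlinarith

theorem sOf_mem_Iio {w : ℂ} (hw : ‖w‖ < 1) : sOf w ∈ Iio (1 : ℝ) := by
  have := norm_nonneg w
  simp only [sOf, mem_Iio]; nlinarith

theorem sOf_mem_Ioo {w : ℂ} (h0 : 0 < ‖w‖) (hw : ‖w‖ < 1) : sOf w ∈ Ioo (-1 : ℝ) 1 := by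
  refine ⟨?_, sOf_mem_Iio hw⟩
  simp only [sOf]; nlinarith

theorem uniqueDiffOn_solidTorus : UniqueDiffOn ℝ solidTorus := by
  refine uniqueDiffOn_convex ((convex_closedBall _ _).prod convex_univ) ?_
  rw [solidTorus, interior_prod_eq, interior_univ]
  exact ⟨(0, 0), Metric.ball_subset_interior_closedBall (Metric.mem_ball_self one_pos), trivial⟩

theorem norm_le_one_of_mem_solidTorus {x : ℂ × ℝ} (hx : x ∈ solidTorus) : ‖x.1‖ ≤ 1 := by
  simpa using hx.1

theorem areaForm_self (v : Fin 2 → ℝ) : areaForm v v = 0 := by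
  simp [areaForm]; ring

theorem areaForm_comm (u v : Fin 2 → ℝ) : areaForm u v = -areaForm v u := by
  simp [areaForm]; ring

/-! ### The spiral embedding: equivariance, injectivity, differential. -/

namespace EigenFrame

variable {A : SpecialLinearGroup (Fin 2) ℤ} (e : EigenFrame A)

theorem a_pos : 0 < e.a := zero_lt_one.trans e.one_lt_a

/-- The area spanned by the eigenvectors. -/
def area : ℝ := areaForm e.vp e.vm

theorem area_pos' : 0 < e.area := by
  have := e.area_pos
  simpa [area, areaForm] using this

/-- The point `p(s) a^{-u} v₊ + s p(s) a^u v₋`, where `s = sOf w`. -/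
def spiralVec (p : ℝ → ℝ) (x : ℂ × ℝ) : Fin 2 → ℝ :=
  (p (sOf x.1) * e.a ^ (-x.2)) • e.vp + (sOf x.1 * p (sOf x.1) * e.a ^ x.2) • e.vm

/-- The map `(w, u) ↦ ((x, z), w)` from `D² × ℝ` to `T_A × ℂ` with `z = u` and
`x = p(s) a^{-u} v₊ + s p(s) a^u v₋`, where `s = sOf w`. -/
def spiralEmb (p : ℝ → ℝ) (x : ℂ × ℝ) : MapTorus A × ℂ :=
  (MapTorus.proj A (e.spiralVec p x, x.2), x.1)

theorem contDiffOn_spiralVec {k : ℕ∞ω} {p : ℝ → ℝ} {U : Set ℝ} {V : Set (ℂ × ℝ)}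
    (hp : ContDiffOn ℝ k p U) (hUV : ∀ x ∈ V, sOf x.1 ∈ U) :
    ContDiffOn ℝ k (e.spiralVec p) V := by
  have h1 : ContDiffOn ℝ k (fun x : ℂ × ℝ => sOf x.1) V :=
    (contDiff_sOf.comp contDiff_fst).contDiffOn
  have h2 : ContDiffOn ℝ k (fun x : ℂ × ℝ => p (sOf x.1)) V := hp.comp h1 hUV
  have h3 : ContDiffOn ℝ k (fun x : ℂ × ℝ => e.a ^ x.2) V :=
    (contDiff_const.rpow contDiff_snd fun _ => e.a_pos.ne').contDiffOn
  have h4 : ContDiffOn ℝ k (fun x : ℂ × ℝ => e.a ^ (-x.2)) V :=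
    (contDiff_const.rpow contDiff_snd.neg fun _ => e.a_pos.ne').contDiffOn
  exact ((h2.mul h4).smul contDiffOn_const).add (((h1.mul h2).mul h3).smul contDiffOn_const)

theorem contMDiffOn_spiralEmb {k : ℕ∞} {p : ℝ → ℝ} {U : Set ℝ} {V : Set (ℂ × ℝ)}
    (hp : ContDiffOn ℝ k p U) (hUV : ∀ x ∈ V, sOf x.1 ∈ U) :
    ContMDiffOn 𝓘(ℝ, ℂ × ℝ) (𝓘(ℝ, SolCover).prod 𝓘(ℝ, ℂ)) k (e.spiralEmb p) V := by
  have h1 : ContDiffOn ℝ k (fun x : ℂ × ℝ => (e.spiralVec p x, x.2)) V :=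
    (e.contDiffOn_spiralVec hp hUV).prodMk contDiff_snd.contDiffOn
  have h2 : ContMDiff 𝓘(ℝ, SolCover) 𝓘(ℝ, SolCover) k (MapTorus.proj A) :=
    (MapTorus.isLocalDiffeomorph_proj (A := A)).contMDiff.of_le (by exact_mod_cast le_top)
  exact (h2.comp_contMDiffOn h1.contMDiffOn).prodMk contDiff_fst.contDiffOn.contMDiffOn

/-- `Aⁿ` scales `v₊` and `v₋` by `aⁿ` and `a⁻ⁿ`, which is the effect of replacing `u` by `u - n` in
the coefficients `a^{-u}` and `a^u`. -/
theorem slLin_zpow_spiralVec (n : ℤ) (p : ℝ → ℝ) (w : ℂ) (u : ℝ) :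
    slLin (A ^ n) (e.spiralVec p (w, u)) = e.spiralVec p (w, u - n) := by
  have ha := e.a_pos
  simp only [spiralVec, map_add, map_smul, slLin_zpow ha.ne' e.map_vp,
    slLin_zpow (inv_ne_zero ha.ne') e.map_vm, smul_smul]
  rw [neg_sub, sub_eq_neg_add (n : ℝ) u, Real.rpow_add ha, Real.rpow_sub ha, Real.rpow_intCast,
    _root_.inv_zpow]
  congr 2
  · ring
  · rw [div_eq_mul_inv]; ring

theorem deck_spiralVec (n : ℤ) (m : Fin 2 → ℤ) (p : ℝ → ℝ) (w : ℂ) (u : ℝ) :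
    deck A n m (e.spiralVec p (w, u), u) =
      (e.spiralVec p (w, u - n) + fun i => (m i : ℝ), u - n) := by
  simp only [deck, e.slLin_zpow_spiralVec]

theorem spiralEmb_add_one (p : ℝ → ℝ) (w : ℂ) (u : ℝ) :
    e.spiralEmb p (w, u + 1) = e.spiralEmb p (w, u) := by
  refine Prod.ext (MapTorus.proj_eq_iff.2 ⟨1, 0, ?_⟩) rfl
  rw [deck_spiralVec]
  ext <;> simp

theorem spiralEmb_inj {p : ℝ → ℝ} {x y : ℂ × ℝ} (h : e.spiralEmb p x = e.spiralEmb p y) :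
    x.1 = y.1 ∧ ∃ n : ℤ, y.2 = x.2 + n := by
  obtain ⟨h1, h2⟩ := Prod.ext_iff.1 h
  obtain ⟨n, m, hnm⟩ := MapTorus.proj_eq_iff.1 h1
  refine ⟨h2, -n, ?_⟩
  have := congrArg Prod.snd hnm
  simpa [deck, sub_eq_add_neg] using this

/-- The differential of `spiralVec`, the profile function having derivative `p'`. -/
def spiralDeriv (p : ℝ → ℝ) (p' : ℝ) (x h : ℂ × ℝ) : Fin 2 → ℝ :=
  (p' * dsOf x.1 h.1 * e.a ^ (-x.2) - p (sOf x.1) * (Real.log e.a * e.a ^ (-x.2)) * h.2) • e.vp +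
  ((sOf x.1 * p' + p (sOf x.1)) * dsOf x.1 h.1 * e.a ^ x.2 +
    sOf x.1 * p (sOf x.1) * (Real.log e.a * e.a ^ x.2) * h.2) • e.vm

theorem exists_hasFDerivWithinAt_spiralVec {p : ℝ → ℝ} (hp : DifferentiableOn ℝ p (Iic 1))
    {x : ℂ × ℝ} (hx : x ∈ solidTorus) :
    ∃ D : ℂ × ℝ →L[ℝ] (Fin 2 → ℝ), HasFDerivWithinAt (e.spiralVec p) D solidTorus x ∧
      ∀ h, D h = e.spiralDeriv p (derivWithin p (Iic 1) (sOf x.1)) x h := by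
  have hs := sOf_mem_Iic (norm_le_one_of_mem_solidTorus hx)
  have h1 : HasFDerivWithinAt (fun x : ℂ × ℝ => sOf x.1)
      ((dsOf x.1).comp (ContinuousLinearMap.fst ℝ ℂ ℝ)) solidTorus x :=
    ((hasFDerivAt_sOf x.1).comp x hasFDerivAt_fst).hasFDerivWithinAt
  have h2 := (hp _ hs).hasDerivWithinAt.comp_hasFDerivWithinAt x h1
    fun y hy => sOf_mem_Iic (norm_le_one_of_mem_solidTorus hy)
  have ha : HasDerivAt (fun u : ℝ => e.a ^ u) (Real.log e.a * e.a ^ x.2) x.2 := by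
    simpa using (hasDerivAt_id x.2).const_rpow e.a_pos
  have hb : HasDerivAt (fun u : ℝ => e.a ^ (-u)) (-(Real.log e.a * e.a ^ (-x.2))) x.2 := by
    simpa using (hasDerivAt_id x.2).neg.const_rpow e.a_pos
  have h0 : HasFDerivWithinAt (fun x : ℂ × ℝ => x.2) (ContinuousLinearMap.snd ℝ ℂ ℝ)
    solidTorus x := hasFDerivWithinAt_snd
  have h3 := ha.comp_hasFDerivWithinAt x h0
  have h4 := hb.comp_hasFDerivWithinAt x h0
  have h5 := ((h2.mul h4).smul_const e.vp).add (((h1.mul h2).mul h3).smul_const e.vm)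
  refine ⟨_, h5, fun h => ?_⟩
  simp only [spiralDeriv, Function.comp_apply, _root_.add_apply, _root_.smul_apply,
    ContinuousLinearMap.smulRight_apply, ContinuousLinearMap.comp_apply,
    ContinuousLinearMap.coe_fst', ContinuousLinearMap.coe_snd', smul_eq_mul, Pi.mul_apply]
  congr 2 <;> ring

theorem mfderivWithin_spiralEmb {p : ℝ → ℝ} (hp : DifferentiableOn ℝ p (Iic 1)) {x : ℂ × ℝ}
    (hx : x ∈ solidTorus) (h : ℂ × ℝ) :
    mfderivWithin 𝓘(ℝ, ℂ × ℝ) (𝓘(ℝ, SolCover).prod 𝓘(ℝ, ℂ)) (e.spiralEmb p) solidTorus x h =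
      (mfderiv 𝓘(ℝ, SolCover) 𝓘(ℝ, SolCover) (MapTorus.proj A) (e.spiralVec p x, x.2)
        (e.spiralDeriv p (derivWithin p (Iic 1) (sOf x.1)) x h, h.2), h.1) := by
  have hu := uniqueDiffOn_solidTorus x hx
  obtain ⟨D, hD, hDh⟩ := e.exists_hasFDerivWithinAt_spiralVec hp hx
  have h0 : HasFDerivWithinAt (fun x : ℂ × ℝ => x.2) (ContinuousLinearMap.snd ℝ ℂ ℝ)
    solidTorus x := hasFDerivWithinAt_snd
  have h1 := hD.prodMk h0
  have h2 : HasMFDerivAt 𝓘(ℝ, SolCover) 𝓘(ℝ, SolCover) (MapTorus.proj A) (e.spiralVec p x, x.2)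
      _ := ((MapTorus.isLocalDiffeomorph_proj (A := A)).mdifferentiable (by simp) _).hasMFDerivAt
  have h3 := h2.comp_hasMFDerivWithinAt x h1.hasMFDerivWithinAt
  have h4 : HasFDerivWithinAt (fun x : ℂ × ℝ => x.1) (ContinuousLinearMap.fst ℝ ℂ ℝ)
    solidTorus x := hasFDerivWithinAt_fst
  have h5 := h3.prodMk h4.hasMFDerivWithinAt
  have h6 : HasMFDerivWithinAt 𝓘(ℝ, ℂ × ℝ) (𝓘(ℝ, SolCover).prod 𝓘(ℝ, ℂ)) (e.spiralEmb p)
    solidTorus x _ := h5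
  rw [h6.mfderivWithin hu.uniqueMDiffWithinAt, ← hDh]
  rfl

end EigenFrame

/-! ### The pulled-back contact form and a criterion for a plastikstufe. -/

namespace LutzProfile

variable {A : SpecialLinearGroup (Fin 2) ℤ} {e : EigenFrame A} (P : LutzProfile e)

theorem G_one : P.G 1 = 0 := by
  have := (P.collar 1 one_ne_zero (by simp) (by simpa using P.ε_pos)).2
  simpa using this

theorem F_one : P.F 1 = 1 := by
  have := (P.collar 1 one_ne_zero (by simp) (by simpa using P.ε_pos)).1
  simpa using this

/-- The pull-back of the contact form under `spiralEmb`. -/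
theorem lutzForm_mfderivWithin_spiralEmb {p : ℝ → ℝ} (hp : DifferentiableOn ℝ p (Iic 1))
    {x : ℂ × ℝ} (hx : x ∈ solidTorus) (h : ℂ × ℝ) :
    P.lutzForm (e.spiralEmb p x)
      (mfderivWithin 𝓘(ℝ, ℂ × ℝ) (𝓘(ℝ, SolCover).prod 𝓘(ℝ, ℂ)) (e.spiralEmb p) solidTorus x h) =
    P.F (sOf x.1) * e.area *
      (p (sOf x.1) + 2 * sOf x.1 * derivWithin p (Iic 1) (sOf x.1)) * dsOf x.1 h.1 +
    P.c * P.G (sOf x.1) * dTheta x.1 h.1 := by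
  rw [e.mfderivWithin_spiralEmb hp hx h]
  refine (P.lutzForm_proj (e.spiralVec p x, x.2) x.1
    ((e.spiralDeriv p (derivWithin p (Iic 1) (sOf x.1)) x h, h.2), h.1)).trans ?_
  have ha : e.a ^ (-x.2) * e.a ^ x.2 = 1 := by
    rw [← Real.rpow_add e.a_pos, neg_add_cancel, Real.rpow_zero]
  -- `β₊` sees only the `v₋` component and `β₋` only the `v₊` component. Their `h.2` terms are `± s
  -- p log a` times the area and cancel; the `ds` terms add up to `(s p)' + s p' = p + 2 s p'`.
  simp only [coverForm, EigenFrame.betaP, EigenFrame.betaM, _root_.add_apply, _root_.smul_apply,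
    ContinuousLinearMap.comp_apply, ContinuousLinearMap.coe_fst', ContinuousLinearMap.coe_snd',
    EigenFrame.spiralDeriv, map_add, map_smul, smul_eq_mul, areaForm_self,
    areaForm_comm e.vm e.vp, ← EigenFrame.area.eq_1]
  generalize e.a ^ (-x.2) = b at *
  generalize e.a ^ x.2 = b' at *
  linear_combination (P.F (sOf x.1) * e.area *
    (p (sOf x.1) + 2 * sOf x.1 * derivWithin p (Iic 1) (sOf x.1)) * dsOf x.1 h.1) * ha

/-- The slope function of the characteristic foliation of `spiralEmb`. -/
def slope (p : ℝ → ℝ) (r : ℝ) : ℝ :=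
  4 * r ^ 3 * (P.F (2 * r ^ 2 - 1) * e.area / P.c) *
    ((p (2 * r ^ 2 - 1) + 2 * (2 * r ^ 2 - 1) * deriv p (2 * r ^ 2 - 1)) / P.G (2 * r ^ 2 - 1))

theorem slope_eventuallyEq_zero {p : ℝ → ℝ} (h0 : ∀ s ≤ 0, p s = 0) :
    P.slope p =ᶠ[𝓝 0] 0 := by
  have hev : ∀ᶠ r : ℝ in 𝓝 0, 2 * r ^ 2 - 1 < 0 := by
    refine ContinuousAt.eventually_lt (by fun_prop) continuousAt_const (by norm_num)
  filter_upwards [hev] with r hr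
  have h1 : p =ᶠ[𝓝 (2 * r ^ 2 - 1)] fun _ => 0 := by
    filter_upwards [Iio_mem_nhds hr] with s hs using h0 s (le_of_lt hs)
  simp [slope, h1.deriv_eq, h1.eq_of_nhds]

theorem contDiffOn_slope {p : ℝ → ℝ} (hp : ContDiffOn ℝ ∞ p (Iio 1)) :
    ContDiffOn ℝ ∞ (P.slope p) (Ioo 0 1) := by
  have hs : ContDiffOn ℝ ∞ (fun r : ℝ => 2 * r ^ 2 - 1) (Ioo 0 1) :=
    ContDiff.contDiffOn (by fun_prop)
  have hmem : ∀ r ∈ Ioo (0 : ℝ) 1, 2 * r ^ 2 - 1 ∈ Ioo (-1 : ℝ) 1 := by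
    rintro r ⟨h0, h1⟩
    constructor <;> nlinarith
  have hmem' : MapsTo (fun r : ℝ => 2 * r ^ 2 - 1) (Ioo 0 1) (Iio 1) := fun r hr => (hmem r hr).2
  have hp1 := hp.comp hs hmem'
  have hp2 := (hp.deriv_of_isOpen (m := ∞) isOpen_Iio (by simp)).comp hs hmem'
  have hF := P.smooth_F.comp_contDiffOn hs
  have hG := P.smooth_G.comp_contDiffOn hs
  have hr : ContDiffOn ℝ ∞ (fun r : ℝ => 4 * r ^ 3) (Ioo 0 1) :=
    ContDiff.contDiffOn (by fun_prop)
  exact (hr.mul ((hF.mul contDiffOn_const).div_const _)).mul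
    ((hp1.add ((contDiffOn_const.mul hs).mul hp2)).div hG
      fun r hr => (P.pos _ (hmem r hr)).2.ne')

/-- Besides the quotient by `G`, the slope contains only a factor continuous at `r = 1` with
positive value `4 area / c`, since `F(1) = 1`. -/
theorem tendsto_abs_slope {p : ℝ → ℝ}
    (hlim : Tendsto (fun s => |(p s + 2 * s * deriv p s) / P.G s|) (𝓝[<] 1) atTop) :
    Tendsto (fun r => |P.slope p r|) (𝓝[<] 1) atTop := by
  have h1 : Tendsto (fun r : ℝ => 2 * r ^ 2 - 1) (𝓝[<] 1) (𝓝[<] 1) := by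
    refine tendsto_nhdsWithin_iff.2 ⟨?_, ?_⟩
    · have : ContinuousAt (fun r : ℝ => 2 * r ^ 2 - 1) 1 := by fun_prop
      have h := this.tendsto.mono_left (nhdsWithin_le_nhds (s := Iio 1))
      norm_num at h
      exact h
    · filter_upwards [Ioo_mem_nhdsLT (show (0 : ℝ) < 1 by norm_num)] with r hr
      obtain ⟨h0, h1⟩ := hr
      simp only [mem_Iio]; nlinarith
  have h2 : ContinuousAt
      (fun r : ℝ => |4 * r ^ 3 * (P.F (2 * r ^ 2 - 1) * e.area / P.c)|) 1 := by
    have := P.smooth_F.continuous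
    fun_prop
  have h3 := h2.tendsto.mono_left (nhdsWithin_le_nhds (s := Iio 1))
  have hpos : 0 < |4 * (1 : ℝ) ^ 3 * (P.F (2 * 1 ^ 2 - 1) * e.area / P.c)| := by
    rw [show (2 * 1 ^ 2 - 1 : ℝ) = 1 by norm_num, P.F_one]
    have := e.area_pos'
    have := P.c_pos
    positivity
  refine (h3.pos_mul_atTop hpos (hlim.comp h1)).congr fun r => ?_
  simp only [slope, Function.comp_apply, ← abs_mul]

theorem isPlastikstufe_spiralEmb {k : ℕ∞} (hk : 1 ≤ k) {p : ℝ → ℝ}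
    (hp : ContDiffOn ℝ k p (Iic 1)) (hp' : ContDiffOn ℝ ∞ p (Iio 1)) (h0 : ∀ s ≤ 0, p s = 0)
    (hlim : Tendsto (fun s => |(p s + 2 * s * deriv p s) / P.G s|) (𝓝[<] 1) atTop) :
    IsPlastikstufe (𝓘(ℝ, SolCover).prod 𝓘(ℝ, ℂ)) k P.lutzForm (e.spiralEmb p '' solidTorus) := by
  have hd : DifferentiableOn ℝ p (Iic 1) :=
    hp.differentiableOn (by exact_mod_cast (zero_lt_one.trans_le hk).ne')
  refine ⟨e.spiralEmb p, P.slope p, e.spiralEmb_add_one p, rfl, ?_, ?_, ?_, ?_, ?_, ?_, ?_, ?_, ?_⟩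
  · exact e.contMDiffOn_spiralEmb hp fun x hx => sOf_mem_Iic (norm_le_one_of_mem_solidTorus hx)
  · exact e.contMDiffOn_spiralEmb hp' fun x hx => sOf_mem_Iio (by simpa using hx.1)
  · intro x _ y _ h
    exact e.spiralEmb_inj h
  -- The derivative of the covering is injective, so the `w` and `z` components alone determine the
  -- tangent vector, whatever `p` is.
  · intro x hx h h' heq
    replace heq := (e.mfderivWithin_spiralEmb hd hx h).symm.trans
      (heq.trans (e.mfderivWithin_spiralEmb hd hx h'))
    have h1 := congrArg Prod.fst heq
    have h2 : h.1 = h'.1 := congrArg Prod.snd heq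
    have hinj := ((MapTorus.isLocalDiffeomorph_proj (A := A)).mfderivToContinuousLinearEquiv
      (by simp) (e.spiralVec p x, x.2)).injective
    have h3 := @hinj
      (e.spiralDeriv p (derivWithin p (Iic 1) (sOf x.1)) x h, h.2)
      (e.spiralDeriv p (derivWithin p (Iic 1) (sOf x.1)) x h', h'.2) h1
    exact Prod.ext h2 (Prod.ext_iff.1 h3).2
  -- On the boundary torus `ds` vanishes on tangent vectors and the `dθ` term has coefficient `G(1)
  -- = 0`.
  · intro x hx hx1 h hh
    have hs : sOf x.1 = 1 := by rw [sOf, hx1]; norm_num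
    rw [P.lutzForm_mfderivWithin_spiralEmb hd hx, dsOf_apply, hh, hs, P.G_one]
    ring
  · intro x hx0 hx1 h h'
    have hx : x ∈ solidTorus := ⟨by simpa using hx1.le, trivial⟩
    have hs := sOf_mem_Ioo hx0 hx1
    have hG := (P.pos _ hs).2.ne'
    have hc := P.c_pos.ne'
    -- The pull-back is a scalar multiple of the spiral form, by `ds = 4 r dr`; the wedge product
    -- then vanishes by antisymmetry.
    have key : ∀ h : ℂ × ℝ, P.lutzForm (e.spiralEmb p x)
        (mfderivWithin 𝓘(ℝ, ℂ × ℝ) (𝓘(ℝ, SolCover).prod 𝓘(ℝ, ℂ)) (e.spiralEmb p) solidTorus x h)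
        = P.c * P.G (sOf x.1) / ‖x.1‖ ^ 2 * spiralForm (P.slope p) x.1 h.1 := by
      intro h
      rw [P.lutzForm_mfderivWithin_spiralEmb hd hx, dsOf_apply, dTheta_apply,
        derivWithin_of_mem_nhds (Iic_mem_nhds hs.2), spiralForm, slope, ← sOf.eq_1]
      have := hx0.ne'
      field_simp
      ring
    rw [key, key]
    ring
  · exact P.contDiffOn_slope hp'
  · refine tendsto_const_nhds.congr' ?_
    filter_upwards [(P.slope_eventuallyEq_zero h0).filter_mono nhdsWithin_le_nhds] with r hr
    simp [hr]
  · exact P.tendsto_abs_slope hlim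

theorem spiralEmb_image_subset (p : ℝ → ℝ) : e.spiralEmb p '' solidTorus ⊆ lutzTube A := by
  rintro _ ⟨x, hx, rfl⟩
  exact ⟨trivial, hx.1⟩

/-- Near the boundary of the tube, `G` tends to `0` from above. -/
theorem tendsto_G_one : Tendsto P.G (𝓝[<] 1) (𝓝[>] 0) := by
  refine tendsto_nhdsWithin_iff.2 ⟨?_, ?_⟩
  · rw [← P.G_one]
    exact P.smooth_G.continuous.continuousAt.tendsto.mono_left nhdsWithin_le_nhds
  · filter_upwards [Ioo_mem_nhdsLT (show (-1 : ℝ) < 1 by norm_num)] with s hs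
    exact (P.pos s hs).2

theorem exists_smooth_plastikstufe : ∃ S : Set (MapTorus A × ℂ), S ⊆ lutzTube A ∧
    IsPlastikstufe (𝓘(ℝ, SolCover).prod 𝓘(ℝ, ℂ)) ∞ P.lutzForm S := by
  refine ⟨_, spiralEmb_image_subset Real.smoothTransition, P.isPlastikstufe_spiralEmb le_top
    Real.smoothTransition.contDiff.contDiffOn Real.smoothTransition.contDiff.contDiffOn
    (fun s hs => Real.smoothTransition.zero_of_nonpos hs) ?_⟩
  set q : ℝ → ℝ := fun s => Real.smoothTransition s + 2 * s * deriv Real.smoothTransition s with hq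
  -- The value at `1` is the maximum, so `p + 2 s p'` tends to `1` while `G` tends to `0`.
  have hd : deriv Real.smoothTransition 1 = 0 := by
    refine IsLocalMax.deriv_eq_zero (Eventually.of_forall fun s => ?_)
    rw [Real.smoothTransition.one_of_one_le le_rfl]
    exact Real.smoothTransition.le_one s
  have hq1 : q 1 = 1 := by
    simp [hq, hd, Real.smoothTransition.one_of_one_le le_rfl]
  have hqc : ContinuousAt q 1 := by
    have h1 := (Real.smoothTransition.contDiff (n := 1)).continuous
    have h2 := (Real.smoothTransition.contDiff (n := 1)).continuous_deriv le_rfl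
    fun_prop
  have h1 := hqc.tendsto.mono_left (nhdsWithin_le_nhds (s := Iio 1))
  rw [hq1] at h1
  have h2 := h1.pos_mul_atTop one_pos P.tendsto_G_one.inv_tendsto_nhdsGT_zero
  exact (tendsto_abs_atTop_atTop.comp h2).congr fun s => by simp [hq, div_eq_mul_inv]

end LutzProfile

/-! ### Closedness of the image and closure of the part over the punctured disk. -/

namespace EigenFrame

variable {A : SpecialLinearGroup (Fin 2) ℤ} (e : EigenFrame A)

/-- Closedness can be tested on the cover. There the image lifts to the points with `‖w‖ ≤ 1` at
which `x` differs from `spiralVec` by an integer vector: a closed condition, `ℤ²` being closed. -/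
theorem isClosed_spiralEmb_image {p : ℝ → ℝ} (hp : ContinuousOn p (Iic 1)) :
    IsClosed (e.spiralEmb p '' solidTorus) := by
  have hq : IsQuotientMap (Prod.map (MapTorus.proj A) (id : ℂ → ℂ)) :=
    (MapTorus.isOpenMap_proj.prodMap IsOpenMap.id).isQuotientMap
      (MapTorus.continuous_proj.prodMap continuous_id)
      (Function.Surjective.prodMap (fun m => ⟨m.out, MapTorus.proj_out m⟩) Function.surjective_id)
  have hZ : IsClosed (univ.pi fun _ : Fin 2 => range ((↑) : ℤ → ℝ)) :=
    isClosed_set_pi fun _ _ => Int.isClosedEmbedding_coe_real.isClosed_range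
  have hC : IsClosed {y : SolCover × ℂ | ‖y.2‖ ≤ 1} :=
    isClosed_le (by fun_prop) continuous_const
  have hV : ContinuousOn (e.spiralVec p) {x | ‖x.1‖ ≤ 1} :=
    (e.contDiffOn_spiralVec (contDiffOn_zero.2 hp) fun x hx => sOf_mem_Iic hx).continuousOn
  have hφ : ContinuousOn (fun y : SolCover × ℂ => y.1.1 - e.spiralVec p (y.2, y.1.2))
      {y | ‖y.2‖ ≤ 1} :=
    (Continuous.continuousOn (by fun_prop)).sub
      (hV.comp (Continuous.continuousOn (by fun_prop)) fun y hy => hy)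
  rw [← hq.isClosed_preimage]
  convert hφ.preimage_isClosed_of_isClosed hC hZ using 1
  ext ⟨⟨x, z⟩, w⟩
  simp only [mem_preimage, mem_image, mem_inter_iff, mem_ofPred_eq, Set.mem_pi, mem_univ,
    forall_true_left, mem_range, Pi.sub_apply]
  constructor
  · rintro ⟨⟨w', u⟩, hx, h⟩
    obtain ⟨h1, rfl⟩ := Prod.ext_iff.1 h
    obtain ⟨n, m, hnm⟩ := MapTorus.proj_eq_iff.1 h1
    refine ⟨norm_le_one_of_mem_solidTorus hx, fun i => ⟨m i, ?_⟩⟩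
    rw [deck_spiralVec] at hnm
    obtain ⟨h2, h3⟩ := Prod.ext_iff.1 hnm
    simp only at h2 h3
    rw [h2, h3]
    simp [spiralEmb]
  · rintro ⟨hw, h⟩
    choose m hm using h
    -- Taking `u = z` leaves only a translation by `ℤ²` to account for, hence `n = 0` below.
    refine ⟨(w, z), ⟨by simpa using hw, trivial⟩, ?_⟩
    refine Prod.ext (MapTorus.proj_eq_iff.2 ⟨0, m, ?_⟩) rfl
    rw [deck_spiralVec]
    ext i
    · simp [hm]
    · simp

/-- The contactization misses both the core `w = 0` and the boundary `‖w‖ = 1`; the closure restores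
exactly these. -/
theorem closure_spiralEmb_image {p : ℝ → ℝ} (hp : ContinuousOn p (Iic 1)) :
    closure (e.spiralEmb p '' ((Metric.ball 0 1 \ {0}) ×ˢ univ)) =
      e.spiralEmb p '' solidTorus := by
  have hsub : (Metric.ball (0 : ℂ) 1 \ {0}) ×ˢ (univ : Set ℝ) ⊆ solidTorus :=
    prod_mono (sdiff_subset.trans Metric.ball_subset_closedBall) subset_rfl
  have hball : closure (Metric.ball (0 : ℂ) 1 \ {0}) = Metric.closedBall 0 1 := by
    refine (closure_minimal (sdiff_subset.trans Metric.ball_subset_closedBall)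
      Metric.isClosed_closedBall).antisymm ?_
    rw [← closure_ball (0 : ℂ) one_ne_zero]
    exact closure_minimal ((dense_compl_singleton (0 : ℂ)).open_subset_closure_inter
      Metric.isOpen_ball) isClosed_closure
  have hcl : closure ((Metric.ball (0 : ℂ) 1 \ {0}) ×ˢ (univ : Set ℝ)) = solidTorus := by
    rw [closure_prod_eq, closure_univ, solidTorus, hball]
  have hc : ContinuousOn (e.spiralEmb p) solidTorus :=
    (e.contMDiffOn_spiralEmb (k := 0) (contDiffOn_zero.2 hp)
      fun x hx => sOf_mem_Iic (norm_le_one_of_mem_solidTorus hx)).continuousOn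
  refine (closure_minimal (image_mono hsub) (e.isClosed_spiralEmb_image hp)).antisymm ?_
  rw [← hcl] at hc
  simpa only [hcl] using hc.image_closure

end EigenFrame

/-! ### The given submanifold as a spiral embedding. -/

namespace LutzProfile

variable {A : SpecialLinearGroup (Fin 2) ℤ} {e : EigenFrame A} (P : LutzProfile e)

/-- The profile function `ε k g(k² s)`, `k = F / G`, of the submanifold `spiralCyl`, seen in the
Lutz tube. -/
def tubeProfile (g : ℝ → ℝ) (ε : ℝ) (s : ℝ) : ℝ :=
  ε * (P.F s / P.G s) * g ((P.F s / P.G s) ^ 2 * s)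

/-- The identification replaces `s` by `k² s` and `a^z` by `a^z / k`, so `a^{-z}` and `a^z s` both
acquire the same factor `k`. The equations keep their form, with `ε g(s)` replaced by `ε k g(k² s)`.
-/
theorem extend_mem_spiralCyl_iff {g : ℝ → ℝ} {ε : ℝ} {y : ℝ × SolCover × ℝ}
    (hy : y.1 ∈ Ioo (-1 : ℝ) 1) : P.extend y ∈ spiralCyl e g ε ↔
      y.2.1.1 = (P.tubeProfile g ε y.1 * e.a ^ (-y.2.1.2)) • e.vp +
        (y.1 * P.tubeProfile g ε y.1 * e.a ^ y.2.1.2) • e.vm := by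
  have hk : 0 < P.F y.1 / P.G y.1 := div_pos (P.pos _ hy).1 (P.pos _ hy).2
  have hla : Real.log e.a ≠ 0 := (Real.log_pos e.one_lt_a).ne'
  have hpow : e.a ^ (Real.log (P.F y.1 / P.G y.1) / Real.log e.a) = P.F y.1 / P.G y.1 := by
    rw [Real.rpow_def_of_pos e.a_pos, mul_div_cancel₀ _ hla, Real.exp_log hk]
  simp only [spiralCyl, extend, mem_ofPred_eq, tubeProfile]
  rw [neg_sub, sub_eq_neg_add (_ / _) y.2.1.2, Real.rpow_add e.a_pos, Real.rpow_sub e.a_pos, hpow]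
  generalize P.F y.1 / P.G y.1 = k at *
  have h1 : ε * (e.a ^ (-y.2.1.2) * k) * g (k ^ 2 * y.1) =
    ε * k * g (k ^ 2 * y.1) * e.a ^ (-y.2.1.2) := by ring
  have h2 : ε * (e.a ^ y.2.1.2 / k) * (k ^ 2 * y.1) * g (k ^ 2 * y.1) =
    y.1 * (ε * k * g (k ^ 2 * y.1)) * e.a ^ y.2.1.2 := by field_simp
  rw [h1, h2]

/-- The equations of the submanifold do not involve `t`, so `(s, t)` sweeps out the whole punctured
disk in polar coordinates. -/
theorem tubePoint_image (g : ℝ → ℝ) (ε : ℝ) :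
    P.tubePoint '' {y | y.1 ∈ Ioo (-1 : ℝ) 1 ∧ P.extend y ∈ spiralCyl e g ε} =
      e.spiralEmb (P.tubeProfile g ε) '' ((Metric.ball 0 1 \ {0}) ×ˢ univ) := by
  ext m
  constructor
  · rintro ⟨⟨s, ⟨x, z⟩, t⟩, ⟨hs, hy⟩, rfl⟩
    rw [P.extend_mem_spiralCyl_iff hs] at hy
    simp only at hs hy
    set w : ℂ := (Real.sqrt ((1 + s) / 2) : ℂ) * Complex.exp ((t / P.c : ℝ) * Complex.I) with hw
    have hn : ‖w‖ = Real.sqrt ((1 + s) / 2) := by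
      rw [hw, norm_mul, Complex.norm_exp_ofReal_mul_I, mul_one, Complex.norm_real,
        Real.norm_of_nonneg (Real.sqrt_nonneg _)]
    have hn2 : ‖w‖ ^ 2 = (1 + s) / 2 := by rw [hn, Real.sq_sqrt (by linarith [hs.1])]
    have hsw : sOf w = s := by rw [sOf, hn2]; ring
    refine ⟨(w, z), ⟨⟨?_, ?_⟩, trivial⟩, ?_⟩
    · have := norm_nonneg w
      rw [mem_ball_zero_iff]
      nlinarith [hs.2]
    · intro h0
      rw [show w = 0 from h0] at hn2
      simp at hn2
      linarith [hs.1]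
    · refine Prod.ext ?_ rfl
      simp only [EigenFrame.spiralEmb, tubePoint, EigenFrame.spiralVec, hsw, ← hy]
  · rintro ⟨⟨w, u⟩, ⟨⟨hw1, hw0⟩, -⟩, rfl⟩
    have hs := sOf_mem_Ioo (norm_pos_iff.2 hw0) (mem_ball_zero_iff.1 hw1)
    refine ⟨(sOf w, (e.spiralVec (P.tubeProfile g ε) (w, u), u), P.c * w.arg), ⟨hs, ?_⟩, ?_⟩
    · rw [P.extend_mem_spiralCyl_iff hs]
      rfl
    · refine Prod.ext rfl ?_
      have h1 : (1 + sOf w) / 2 = ‖w‖ ^ 2 := by rw [sOf]; ring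
      simp only [tubePoint, EigenFrame.spiralEmb, h1, Real.sqrt_sq (norm_nonneg w),
        mul_div_cancel_left₀ _ P.c_pos.ne', Complex.norm_mul_exp_arg_mul_I]

theorem compactification_eq {g : ℝ → ℝ} {ε : ℝ}
    (hp : ContinuousOn (P.tubeProfile g ε) (Iic 1)) :
    P.compactification g ε = e.spiralEmb (P.tubeProfile g ε) '' solidTorus := by
  rw [compactification, P.tubePoint_image, e.closure_spiralEmb_image hp]

end LutzProfile

/-! ## Behaviour of the profile at the boundary of the tube -/

/-- The function `b - c σ² - 2 log σ`. -/
def logWeight (b c σ : ℝ) : ℝ := b - c * σ ^ 2 - 2 * Real.log σ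

/-- `Real.log σ` means `log |σ|`, so the limit is two-sided and differentiability at `0` can be
discussed without one-sided derivatives. -/
theorem tendsto_logWeight (b c : ℝ) : Tendsto (logWeight b c) (𝓝[≠] 0) atTop := by
  have h1 : Tendsto (fun σ : ℝ => b - c * σ ^ 2) (𝓝[≠] 0) (𝓝 (b - c * 0 ^ 2)) :=
    (Continuous.tendsto (by fun_prop) 0).mono_left nhdsWithin_le_nhds
  have h2 : Tendsto (fun σ => -(2 * Real.log σ)) (𝓝[≠] 0) atTop :=
    tendsto_neg_atBot_atTop.comp (Real.tendsto_log_nhdsNE_zero.const_mul_atBot two_pos)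
  exact h1.add_atTop h2

theorem hasDerivAt_logWeight (b c : ℝ) {σ : ℝ} (hσ : σ ≠ 0) :
    HasDerivAt (logWeight b c) (-(2 * c * σ) - 2 * σ⁻¹) σ := by
  have h := (((hasDerivAt_pow 2 σ).const_mul c).const_sub b).sub
    ((Real.hasDerivAt_log hσ).const_mul 2)
  refine h.congr_deriv ?_
  simp only [Nat.cast_ofNat, Nat.add_one_sub_one, pow_one]
  ring

/-- The derivative of `σ / logWeight b c σ` away from `0`. -/
def divLogWeightDeriv (b c σ : ℝ) : ℝ :=
  (logWeight b c σ)⁻¹ + (2 * c * σ ^ 2 + 2) * (logWeight b c σ)⁻¹ ^ 2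

theorem hasDerivAt_div_logWeight (b c : ℝ) {σ : ℝ} (hσ : σ ≠ 0) (hl : logWeight b c σ ≠ 0) :
    HasDerivAt (fun σ => σ / logWeight b c σ) (divLogWeightDeriv b c σ) σ := by
  refine ((hasDerivAt_id' σ).div (hasDerivAt_logWeight b c hσ) hl).congr_deriv ?_
  rw [divLogWeightDeriv]
  field_simp
  ring

theorem hasDerivAt_div_logWeight_zero (b c : ℝ) :
    HasDerivAt (fun σ => σ / logWeight b c σ) 0 0 := by
  rw [hasDerivAt_iff_tendsto_slope]
  refine (tendsto_logWeight b c).inv_tendsto_atTop.congr' ?_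
  filter_upwards [self_mem_nhdsWithin] with σ hσ
  have : σ ≠ 0 := hσ
  simp [slope_def_field]
  field_simp

/-- The derivative is a combination of `1 / L` and `1 / L²`, where `L` is `logWeight`; both tend to
`0`, its value at `0`. The convergence is only logarithmic, so no second derivative exists there. -/
theorem contDiffAt_div_logWeight (b c : ℝ) :
    ContDiffAt ℝ 1 (fun σ => σ / logWeight b c σ) 0 := by
  have hpos := (tendsto_logWeight b c).eventually_gt_atTop 0
  refine contDiffAt_one_iff.2
    ⟨fun σ => ContinuousLinearMap.toSpanSingleton ℝ
      (Function.update (divLogWeightDeriv b c) 0 0 σ),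
      {σ | σ ≠ 0 → 0 < logWeight b c σ}, eventually_nhdsWithin_iff.1 hpos, ?_, ?_⟩
  · refine (ContinuousLinearMap.toSpanSingletonCLE (𝕜 := ℝ) (E := ℝ)).continuous.comp_continuousOn
      fun σ hσ => ContinuousAt.continuousWithinAt ?_
    rcases eq_or_ne σ 0 with rfl | h0
    · rw [continuousAt_update_same]
      have hi := (tendsto_logWeight b c).inv_tendsto_atTop
      have h2 : Tendsto (fun σ : ℝ => 2 * c * σ ^ 2 + 2) (𝓝[≠] 0) (𝓝 (2 * c * 0 ^ 2 + 2)) :=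
        (Continuous.tendsto (by fun_prop) 0).mono_left nhdsWithin_le_nhds
      have h3 := hi.add (h2.mul (hi.pow 2))
      rw [zero_pow two_ne_zero, mul_zero, add_zero] at h3
      exact h3
    · rw [continuousAt_update_of_ne h0]
      have hl := (hasDerivAt_logWeight b c h0).continuousAt.inv₀ (hσ h0).ne'
      exact hl.add (ContinuousAt.mul (by fun_prop) (hl.pow 2))
  · intro σ hσ
    rcases eq_or_ne σ 0 with rfl | h0
    · simpa using (hasDerivAt_div_logWeight_zero b c).hasFDerivAt
    · simpa [h0] using (hasDerivAt_div_logWeight b c h0 (hσ h0).ne').hasFDerivAt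

/-- `σ log σ → 0`. The reciprocal of this product is the lower bound for the slope at the boundary.
-/
theorem tendsto_mul_logWeight (b c : ℝ) :
    Tendsto (fun σ => σ * logWeight b c σ) (𝓝[>] 0) (𝓝[>] 0) := by
  refine tendsto_nhdsWithin_iff.2 ⟨?_, ?_⟩
  · have h : Continuous fun σ : ℝ => σ * (b - c * σ ^ 2) - 2 * (σ * Real.log σ) := by
      have := Real.continuous_mul_log
      fun_prop
    have h1 := (h.tendsto 0).mono_left (nhdsWithin_le_nhds (s := Ioi 0))
    simp only [zero_mul, mul_zero, sub_zero] at h1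
    exact h1.congr fun σ => by rw [logWeight]; ring
  · have h1 := ((tendsto_logWeight b c).mono_left
      (nhdsWithin_mono 0 fun σ (h : 0 < σ) => h.ne')).eventually_gt_atTop 0
    filter_upwards [h1, self_mem_nhdsWithin] with σ h hσ
    exact mul_pos hσ h

/-! ### Regularity of the profile and blow-up of the slope at the boundary. -/

namespace LutzProfile

variable {A : SpecialLinearGroup (Fin 2) ℤ} {e : EigenFrame A} (P : LutzProfile e)

/-- The profile `tubeProfile` with `ε = 1` near the boundary, as a function of `σ = -τ`. -/
def collarProfile (σ : ℝ) : ℝ :=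
  Real.exp (σ ^ 2 / P.ε + σ) / P.ε * (σ / logWeight (2 * Real.log P.ε) (2 / P.ε) σ)

theorem contDiffAt_collarProfile : ContDiffAt ℝ 1 P.collarProfile 0 :=
  ContDiffAt.mul (by fun_prop) (contDiffAt_div_logWeight _ _)

theorem hasDerivAt_collarProfile {σ : ℝ} (hσ : σ ≠ 0)
    (hl : logWeight (2 * Real.log P.ε) (2 / P.ε) σ ≠ 0) :
    HasDerivAt P.collarProfile
      ((2 * σ / P.ε + 1) * P.collarProfile σ + Real.exp (σ ^ 2 / P.ε + σ) / P.ε *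
        divLogWeightDeriv (2 * Real.log P.ε) (2 / P.ε) σ) σ := by
  have h1 : HasDerivAt (fun σ : ℝ => σ ^ 2 / P.ε + σ) (2 * σ / P.ε + 1) σ := by
    simpa using ((hasDerivAt_pow 2 σ).div_const P.ε).fun_add (hasDerivAt_id' σ)
  refine ((h1.exp.div_const P.ε).mul (hasDerivAt_div_logWeight _ _ hσ hl)).congr_deriv ?_
  rw [collarProfile]
  ring

theorem tubeProfile_of_nonpos {g : ℝ → ℝ} (hg : ∀ s ≤ 1, g s = 0) (ε : ℝ) {s : ℝ} (hs : s ≤ 0) :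
    P.tubeProfile g ε s = 0 := by
  rw [tubeProfile, hg, mul_zero]
  exact (mul_nonpos_of_nonneg_of_nonpos (sq_nonneg _) hs).trans zero_le_one

theorem contDiffAt_tubeProfile {g : ℝ → ℝ} (hgs : ContDiff ℝ ∞ g) (hg : ∀ s ≤ 1, g s = 0)
    (ε : ℝ) {s : ℝ} (hs : s < 1) : ContDiffAt ℝ ∞ (P.tubeProfile g ε) s := by
  -- For negative `s` the quotient `F / G` is not controlled (`G` vanishes at `s = -1`), but the
  -- profile is identically zero there.
  rcases lt_or_ge s 0 with h0 | h0
  · refine (contDiffAt_const (c := (0 : ℝ))).congr_of_eventuallyEq ?_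
    filter_upwards [Iio_mem_nhds h0] with t ht using P.tubeProfile_of_nonpos hg ε (le_of_lt ht)
  · have hG := (P.pos s ⟨by linarith, hs⟩).2
    have hk := P.smooth_F.contDiffAt.div P.smooth_G.contDiffAt hG.ne'
    exact (contDiffAt_const.mul hk).mul
      (hgs.contDiffAt.comp s ((hk.pow 2).mul contDiffAt_id))

/-- The collar formula for `tubeProfile`. -/
theorem tubeProfile_collar {g : ℝ → ℝ} (hg : ∀ s, 2 ≤ s → g s = 1 / (s * Real.log s)) (ε : ℝ)
    {s : ℝ} (hs0 : 0 < s) (hs1 : s < 1) (hs : -P.ε < Real.log s / 2)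
    (hk : 2 ≤ (P.F s / P.G s) ^ 2 * s) :
    P.tubeProfile g ε s = ε * P.collarProfile (-(Real.log s / 2)) := by
  obtain ⟨hF, hG⟩ := P.collar s hs0.ne' (by rw [abs_of_pos hs0]; exact hs1.le)
    (by rwa [abs_of_pos hs0])
  rw [abs_of_pos hs0] at hF hG
  have hε := P.ε_pos
  have hσ : 0 < -(Real.log s / 2) := by have := Real.log_neg hs0 hs1; linarith
  set σ := -(Real.log s / 2) with hσd
  have hs' : s = Real.exp (-2 * σ) := by
    rw [hσd, show -2 * -(Real.log s / 2) = Real.log s by ring, Real.exp_log hs0]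
  have hτ : Real.log s / 2 = -σ := by rw [hσd]; ring
  rw [hτ] at hF
  have hks : P.F s / P.G s * s = Real.exp (-(σ ^ 2 / P.ε + σ)) * P.ε / σ := by
    have : Real.exp (-(σ ^ 2 / P.ε + σ)) = Real.exp (-(-σ) ^ 2 / P.ε - -σ) * s := by
      rw [hs', ← Real.exp_add]; congr 1; ring
    rw [hF, hG, this]
    field_simp
  -- Since `s = e^{-2σ}`, the terms linear in `σ` cancel in `(k s)² / s`. This is why `logWeight`
  -- has no linear term.
  have hk2 : (P.F s / P.G s) ^ 2 * s = Real.exp (-(2 / P.ε * σ ^ 2)) * P.ε ^ 2 / σ ^ 2 := by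
    have : (P.F s / P.G s) ^ 2 * s = (P.F s / P.G s * s) ^ 2 / s := by field_simp
    rw [this, hks]
    have h2 : Real.exp (-(2 / P.ε * σ ^ 2)) * s = Real.exp (-(σ ^ 2 / P.ε + σ)) ^ 2 := by
      rw [hs', ← Real.exp_add, ← Real.exp_nat_mul]; congr 1; push_cast; ring
    rw [div_eq_div_iff hs0.ne' (by positivity), div_pow, mul_pow, ← h2]
    field_simp
  have hlog : Real.log ((P.F s / P.G s) ^ 2 * s) =
      logWeight (2 * Real.log P.ε) (2 / P.ε) σ := by
    rw [hk2, Real.log_div (by positivity) (by positivity),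
      Real.log_mul (by positivity) (by positivity), Real.log_exp, Real.log_pow, Real.log_pow,
      logWeight]
    push_cast; ring
  have hkne : P.F s / P.G s ≠ 0 := by
    intro h0
    rw [h0] at hk
    norm_num at hk
  have hfin : P.F s / P.G s * (1 / ((P.F s / P.G s) ^ 2 * s)) = 1 / (P.F s / P.G s * s) := by
    generalize P.F s / P.G s = k at *
    field_simp
  have hexp : (Real.exp (-(σ ^ 2 / P.ε + σ)) * P.ε / σ)⁻¹ =
      Real.exp (σ ^ 2 / P.ε + σ) / P.ε * σ := by
    rw [Real.exp_neg]; field_simp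
  calc P.tubeProfile g ε s
      = ε * (P.F s / P.G s * (1 / ((P.F s / P.G s) ^ 2 * s))) *
          (logWeight (2 * Real.log P.ε) (2 / P.ε) σ)⁻¹ := by
        rw [tubeProfile, hg _ hk, hlog, one_div, mul_inv, one_div]; ring
    _ = ε * P.collarProfile σ := by
        rw [hfin, hks, one_div, hexp, collarProfile]; ring

/-- As `F → 1` and `G → 0` from above, `k² s` tends to infinity, so the explicit formula for `g`
applies near the boundary. -/
theorem eventually_collar : ∀ᶠ s in 𝓝[<] (1 : ℝ), 0 < s ∧ s < 1 ∧ -P.ε < Real.log s / 2 ∧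
    2 ≤ (P.F s / P.G s) ^ 2 * s := by
  have hF : Tendsto P.F (𝓝[<] 1) (𝓝 1) := by
    have h : ContinuousAt P.F 1 := P.smooth_F.continuous.continuousAt
    exact (P.F_one ▸ h.tendsto).mono_left nhdsWithin_le_nhds
  have hk : Tendsto (fun s => P.F s / P.G s) (𝓝[<] 1) atTop :=
    hF.pos_mul_atTop one_pos P.tendsto_G_one.inv_tendsto_nhdsGT_zero
  have hk2 : Tendsto (fun s => (P.F s / P.G s) ^ 2 * s) (𝓝[<] 1) atTop :=
    ((tendsto_pow_atTop two_ne_zero).comp hk).atTop_mul_pos one_pos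
      (tendsto_id.mono_left nhdsWithin_le_nhds)
  have hlog : ∀ᶠ s in 𝓝 (1 : ℝ), -P.ε < Real.log s / 2 := by
    refine ContinuousAt.eventually_lt continuousAt_const
      ((Real.continuousAt_log one_ne_zero).div_const 2) ?_
    simpa using P.ε_pos
  filter_upwards [hk2.eventually_ge_atTop 2, hlog.filter_mono nhdsWithin_le_nhds,
    Ioo_mem_nhdsLT (show (0 : ℝ) < 1 by norm_num)] with s h1 h2 h3
  exact ⟨h3.1, h3.2, h2, h1⟩

theorem tubeProfile_eventuallyEq {g : ℝ → ℝ} (hg : ∀ s, 2 ≤ s → g s = 1 / (s * Real.log s))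
    (ε : ℝ) : P.tubeProfile g ε =ᶠ[𝓝[≤] 1]
      fun s => ε * P.collarProfile (-(Real.log s / 2)) := by
  rw [← Iio_insert, EventuallyEq, nhdsWithin_insert, eventually_sup, eventually_pure]
  -- At `s = 1` the quotient `F / G` is `1 / 0 = 0`, so the profile takes the value `0`, which is
  -- also its limit.
  refine ⟨by simp [tubeProfile, collarProfile, P.G_one], ?_⟩
  filter_upwards [P.eventually_collar] with s hs using
    P.tubeProfile_collar hg ε hs.1 hs.2.1 hs.2.2.1 hs.2.2.2

theorem contDiffOn_tubeProfile {g : ℝ → ℝ} (hgs : ContDiff ℝ ∞ g) (hg0 : ∀ s ≤ 1, g s = 0)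
    (hg : ∀ s, 2 ≤ s → g s = 1 / (s * Real.log s)) (ε : ℝ) :
    ContDiffOn ℝ 1 (P.tubeProfile g ε) (Iic 1) := by
  intro s hs
  rcases lt_or_eq_of_le (mem_Iic.1 hs) with h | rfl
  · exact ((P.contDiffAt_tubeProfile hgs hg0 ε h).of_le (by simp)).contDiffWithinAt
  · have hev := P.tubeProfile_eventuallyEq hg ε
    refine ContDiffWithinAt.congr_of_eventuallyEq ?_ hev (hev.self_of_nhdsWithin self_mem_Iic)
    have hlog : ContDiffAt ℝ 1 (fun s => -(Real.log s / 2)) 1 :=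
      ((Real.contDiffAt_log.2 one_ne_zero).div_const 2).neg
    refine (contDiffAt_const.mul (ContDiffAt.comp (g := P.collarProfile) 1 ?_ hlog)).contDiffWithinAt
    simpa using P.contDiffAt_collarProfile

theorem tendsto_tubeProfile {g : ℝ → ℝ} (hg : ∀ s, 2 ≤ s → g s = 1 / (s * Real.log s))
    {ε : ℝ} (hε : 0 < ε) :
    Tendsto (fun s => |(P.tubeProfile g ε s + 2 * s * deriv (P.tubeProfile g ε) s) / P.G s|)
      (𝓝[<] 1) atTop := by
  set b := 2 * Real.log P.ε with hb
  set c := 2 / P.ε with hc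
  have hε' := P.ε_pos
  have hσ : Tendsto (fun s => -(Real.log s / 2)) (𝓝[<] 1) (𝓝[>] 0) := by
    refine tendsto_nhdsWithin_iff.2 ⟨?_, ?_⟩
    · have h : ContinuousAt (fun s => -(Real.log s / 2)) 1 :=
        ((Real.continuousAt_log one_ne_zero).div_const 2).neg
      have h1 := h.tendsto.mono_left (nhdsWithin_le_nhds (s := Iio 1))
      simpa using h1
    · filter_upwards [Ioo_mem_nhdsLT (show (0 : ℝ) < 1 by norm_num)] with s hs
      have := Real.log_neg hs.1 hs.2
      simp only [mem_Ioi]; linarith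
  -- The function `ε / (σ L)`, with `L` the value of `logWeight` at `σ`, will bound the quotient
  -- from below.
  have hmain : Tendsto (fun s => ε * (-(Real.log s / 2) * logWeight b c (-(Real.log s / 2)))⁻¹)
      (𝓝[<] 1) atTop :=
    (((tendsto_mul_logWeight b c).comp hσ).inv_tendsto_nhdsGT_zero).const_mul_atTop hε
  refine tendsto_atTop_mono' _ ?_ hmain
  -- Equality on a full neighbourhood of each `s < 1` is needed in order to differentiate.
  have hcol : ∀ᶠ s in 𝓝[<] (1 : ℝ),
      P.tubeProfile g ε =ᶠ[𝓝 s] fun s => ε * P.collarProfile (-(Real.log s / 2)) := by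
    have h := eventually_eventually_nhdsWithin.2 P.eventually_collar
    filter_upwards [h, self_mem_nhdsWithin] with s hs hs1
    rw [isOpen_Iio.nhdsWithin_eq hs1] at hs
    filter_upwards [hs] with t ht using P.tubeProfile_collar hg ε ht.1 ht.2.1 ht.2.2.1 ht.2.2.2
  filter_upwards [hcol, P.eventually_collar, hσ.eventually self_mem_nhdsWithin,
    ((tendsto_mul_logWeight b c).comp hσ).eventually self_mem_nhdsWithin]
    with s hs ⟨hs0, hs1, hs2, _⟩ hσ0 hσl
  have hG := (P.collar s hs0.ne' (by rw [abs_of_pos hs0]; exact hs1.le)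
    (by rwa [abs_of_pos hs0])).2
  rw [abs_of_pos hs0] at hG
  rw [hs.deriv_eq, hs.eq_of_nhds, hG]
  have hlog : HasDerivAt (fun s => -(Real.log s / 2)) (-(s⁻¹ / 2)) s :=
    ((Real.hasDerivAt_log hs0.ne').div_const 2).neg
  simp only [Function.comp_apply] at hσ0 hσl
  generalize hσd : -(Real.log s / 2) = σ at *
  have hl : 0 < logWeight b c σ := pos_of_mul_pos_right hσl hσ0.le
  have hV := P.hasDerivAt_collarProfile hσ0.ne' hl.ne'
  have hdV := (HasDerivAt.comp s (hσd ▸ hV) hlog).const_mul ε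
  rw [hσd, ← hb, ← hc] at hdV
  have hd : deriv (fun s => ε * P.collarProfile (-(Real.log s / 2))) s = _ := hdV.deriv
  rw [hd]
  set d := divLogWeightDeriv b c σ with hdd
  set M := Real.exp (σ ^ 2 / P.ε + σ) / P.ε with hM
  have hM1 : 1 / P.ε ≤ M := by
    have : 0 ≤ σ ^ 2 / P.ε + σ := by positivity
    rw [hM]
    gcongr
    exact Real.one_le_exp this
  have hd1 : (logWeight b c σ)⁻¹ ≤ d := by
    have : 0 ≤ c := by positivity
    rw [hdd, divLogWeightDeriv]
    exact le_add_of_nonneg_right (by positivity)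
  have hV0 : 0 ≤ P.collarProfile σ := by
    rw [collarProfile]
    positivity
  -- As `2 s d/ds = -d/dσ`, the undifferentiated term cancels and both remaining terms have the same
  -- sign. Dropping the first and using `M ≥ 1 / P.ε` and `d ≥ 1 / L` gives the bound.
  have heq : (ε * P.collarProfile σ + 2 * s * (ε * (((2 * σ / P.ε + 1) * P.collarProfile σ +
      M * d) * -(s⁻¹ / 2)))) / (σ / P.ε) =
      -(ε * (2 * P.collarProfile σ) + ε * (P.ε * (M * d)) / σ) := by
    field_simp
    ring
  rw [heq, abs_neg]
  refine le_trans ?_ (le_abs_self _)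
  refine le_add_of_nonneg_of_le (by positivity) ?_
  have hMd : 1 / P.ε * (logWeight b c σ)⁻¹ ≤ M * d := by gcongr
  calc ε * (σ * logWeight b c σ)⁻¹
      = ε * (P.ε * (1 / P.ε * (logWeight b c σ)⁻¹)) / σ := by field_simp
    _ ≤ _ := by gcongr

end LutzProfile

end

theorem mainTheorem4 (A : SpecialLinearGroup (Fin 2) ℤ) (hA : 2 < A.1.trace)
    (e : EigenFrame A) (P : LutzProfile e) :
    (∃ S : Set (MapTorus A × ℂ), S ⊆ lutzTube A ∧
      IsPlastikstufe (𝓘(ℝ, SolCover).prod 𝓘(ℝ, ℂ)) ∞ P.lutzForm S) ∧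
    ∀ g : ℝ → ℝ, ContDiff ℝ ∞ g → (∀ s ≤ 1, g s = 0) →
      (∀ s, 2 ≤ s → g s = 1 / (s * Real.log s)) →
      ∃ ε₀ > 0, ∀ ε, 0 < ε → ε < ε₀ →
        P.compactification g ε ⊆ lutzTube A ∧
        IsPlastikstufe (𝓘(ℝ, SolCover).prod 𝓘(ℝ, ℂ)) 1 P.lutzForm (P.compactification g ε) := by
  -- Embeddedness and blow-up hold for every amplitude `ε > 0`, so the threshold `1` is arbitrary.
  refine ⟨P.exists_smooth_plastikstufe, fun g hgs hg0 hg => ⟨1, one_pos, fun ε hε _ => ?_⟩⟩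
  have hp := P.contDiffOn_tubeProfile hgs hg0 hg ε
  rw [P.compactification_eq hp.continuousOn]
  exact ⟨LutzProfile.spiralEmb_image_subset _, P.isPlastikstufe_spiralEmb le_rfl hp
    (fun s hs => (P.contDiffAt_tubeProfile hgs hg0 ε hs).contDiffWithinAt)
    (fun s hs => P.tubeProfile_of_nonpos hg0 ε hs) (P.tendsto_tubeProfile hg hε)⟩
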